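/- Let $\alpha>-1$ and $s>0$. Let $\mathbb D\subset\mathbb C$ be the open unit disk, $dz$ the Lebesgue measure, and let $\mathbf B^2_\alpha$ be the space of holomorphic functions $f$ on $\mathbb D$ with $\|f\|_{\mathbf B^2_\alpha}^2=\int_{\mathbb D}|f(z)|^2(1-|z|^2)^\alpha\,dz<\infty$, with scalar product $\langle f,g\rangle_\alpha=\int_{\mathbb D} f\,\overline g\,(1-|z|^2)^\alpha\,dz$. Let $d\mu(z)=(1-|z|^2)^{-2}dz$ be the hyperbolic measure on $\mathbb D$. For $f\in\mathbf B^2_\alpha$ put $u_f(z)=|f(z)|^2(1-|z|^2)^{\alpha+2}$, let $u_f^*(s)=\inf\{t\ge 0:\mu(\{u_f>t\})\le s\}$ be its decreasing rearrangement with respect to $\mu$ (the inverse of the distribution function $t\mapsto\mu(\{u_f>t\})$), and, for $f\neq0$, set $$\mathcal K_\alpha[f]=\frac{1}{\|f\|_{\mathbf B^2_\alpha}^2}\int_{\{u_f>u_f^*(s)\}}u_f\,d\mu .$$ Let $\mathbf f_0=\sqrt{(\alpha+1)/\pi}$ be the constant function of norm $1$. Then for every $g\in\mathbf B^2_\alpha$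 with $\|g\|_{\mathbf B^2_\alpha}=1$ and $\langle g,1\rangle_\alpha=\langle g,z\rangle_\alpha=0$, the function $\varepsilon\mapsto\mathcal K_\alpha[\mathbf f_0+\varepsilon g]$ of the real variable $\varepsilon$ is twice differentiable at $\varepsilon=0$, and its second derivative there, $\nabla^2\mathcal K_\alpha[\mathbf f_0](g,g)$, satisfies $$\frac12\nabla^2\mathcal K_\alpha[\mathbf f_0](g,g)\le-\frac{\alpha+1}{2}\,\pi^{\alpha+1}\,s\,(\pi+s)^{-3-\alpha}\,(s+2\pi).$$ -/

import Mathlib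

open Real MeasureTheory Filter Topology

noncomputable section

namespace Bergman

/-- The open unit disk of `ℂ`. -/
def disk : Set ℂ := Metric.ball 0 1

/-- The weighted Bergman space of the unit disk: functions holomorphic in the disk with
`∫_𝔻 |f|² (1 - |z|²)^α dz < ∞`. Only the values in the disk matter. -/
def space (α : ℝ) : Set (ℂ → ℂ) :=
  {f | DifferentiableOn ℂ f disk ∧
    IntegrableOn (fun z => ‖f z‖ ^ 2 * (1 - ‖z‖ ^ 2) ^ α) disk volume}

/-- The scalar product `⟨f, g⟩ = ∫_𝔻 f \bar g (1 - |z|²)^α dz`. -/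
def scalar (α : ℝ) (f g : ℂ → ℂ) : ℂ :=
  ∫ z in disk, f z * (starRingEnd ℂ) (g z) * (((1 - ‖z‖ ^ 2) ^ α : ℝ) : ℂ)

/-- The norm of the weighted Bergman space. -/
def norm (α : ℝ) (f : ℂ → ℂ) : ℝ :=
  √(∫ z in disk, ‖f z‖ ^ 2 * (1 - ‖z‖ ^ 2) ^ α)

/-- The hyperbolic measure `(1 - |z|²)⁻² dz` on the disk. -/
def hyp : Measure ℂ :=
  (volume.restrict disk).withDensity (fun z => ENNReal.ofReal (((1 - ‖z‖ ^ 2) ^ 2)⁻¹))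

/-- `u(z) = |f(z)|² (1 - |z|²)^(α + 2)`. -/
def u (α : ℝ) (f : ℂ → ℂ) (z : ℂ) : ℝ := ‖f z‖ ^ 2 * (1 - ‖z‖ ^ 2) ^ (α + 2)

/-- The superlevel set `{z ∈ 𝔻 : u(z) > t}`. -/
def superlevel (α : ℝ) (f : ℂ → ℂ) (t : ℝ) : Set ℂ := {z | z ∈ disk ∧ t < u α f z}

/-- The decreasing rearrangement `u^*(s)`: the (generalized) inverse at `s` of the distribution
function `t ↦ μ({u > t})`, with `μ` the hyperbolic measure. -/
def uStar (α : ℝ) (f : ℂ → ℂ) (s : ℝ) : ℝ :=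
  sInf {t : ℝ | 0 ≤ t ∧ hyp (superlevel α f t) ≤ ENNReal.ofReal s}

/-- `I_f(s) = ∫_{u > u^*(s)} u dμ`. -/
def I (α : ℝ) (f : ℂ → ℂ) (s : ℝ) : ℝ :=
  ∫ z in superlevel α f (uStar α f s), u α f z ∂hyp

/-- The functional `𝒦_α[f] = I_f(s) / ‖f‖²`. -/
def K (α s : ℝ) (f : ℂ → ℂ) : ℝ := I α f s / norm α f ^ 2

/-- The normalized constant function `f₀ = √((α + 1) / π)`. -/
def f₀ (α : ℝ) : ℂ → ℂ := fun _ => ((√((α + 1) / π) : ℝ) : ℂ)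

/-- `ε ↦ 𝒦_α[f₀ + ε g]`, for real `ε`. -/
def KLine (α s : ℝ) (g : ℂ → ℂ) (ε : ℝ) : ℝ := K α s (fun z => f₀ α z + (ε : ℂ) * g z)

/-- The second variation `∇²𝒦_α[f₀](g, g) = d²/dε² 𝒦_α[f₀ + ε g]` at `ε = 0`. -/
def secondVariation (α s : ℝ) (g : ℂ → ℂ) : ℝ := deriv (deriv (KLine α s g)) 0

/-- `ε ↦ 𝒦_α[f₀ + ε g]` is twice differentiable at `0`, so that the second variation is a genuine
second derivative. -/
def HasSecondVariation (α s : ℝ) (g : ℂ → ℂ) : Prop :=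
  (∀ᶠ ε in 𝓝 (0 : ℝ), DifferentiableAt ℝ (KLine α s g) ε) ∧
    DifferentiableAt ℝ (deriv (KLine α s g)) 0

end Bergman

end

/-! Write `c = c₀ α`, `w = (1 - |z|²)^(α + 2)` and `u_ε` for the function attached to `f₀ + ε g`, so
that `u_ε = c² w + 2 c ε (Re g) w + ε² |g|² w`. Orthogonality to `1` gives `‖f₀ + ε g‖² = 1 + ε²`
(`norm_pert_sq`). Everything therefore reduces to the second order behaviour at `0` of `I(ε)`, the
integral of `u_ε dμ` over its superlevel set `Ω_ε` of hyperbolic area `s`, since half the second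
derivative of `I(ε) / (1 + ε²)` is `I''(0) / 2 - I(0)`.

First derivative. By the bathtub principle `I(ε')` is at least the integral of `u_ε'` over `Ω_ε`,
and `u_ε` is convex in `ε`. Hence the integral of `∂_ε u_ε` over `Ω_ε` (`slopeAt`) is a subgradient
of `I` at `ε`. It depends continuously on `ε`, so it is the derivative (`hasDerivAt_I`). No
regularity of the boundary of `Ω_ε` or of the level `u^*(s)` is needed.

Second derivative. `Ω_0` is the disk of radius `R`, `R² = s / (π + s)`. At the fixed level of `u_0`
on the circle `|z| = R`, the boundary of the superlevel set moves radially by `ε Re g(R e^{iθ}) (1 -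
R²) / (c (α + 2) R) + o(ε)`. This has zero mean because `g(0) = 0`, so the area of the fixed-level
set is `s + o(ε)` and `Ω_ε` may be replaced by it to first order (`hasDerivAt_integral_optimalSet`).
Differentiating `slopeAt` at `0` gives twice the quadratic form `π (1 - R²)^(α + 1) / (α + 2) *
(mean of |g|² on |z| = R) + ∫_{|z| < R} |g|² (1 - |z|²)^α`.

Estimate. Orthogonality to `1` and `z` gives `g = z² h` with `h` holomorphic, so the circle means of
`|g|²` are `r⁴ N(r)` with `N` nondecreasing. The form is linear in `N`, and for a fixed total mass
it is largest when `N` is constant, that is for multiples of `z²` (`radial_inequality`). The value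
there is `momentRatio`, and subtracting `I(0) = 1 - (1 - R²)^(α + 1)` gives the bound. -/

noncomputable section

/-! ### Polar coordinates and circle averages. -/

namespace Bergman

/-- The parameter domain of polar coordinates. -/
def polarDomain : Set (ℝ × ℝ) := Set.Ioi 0 ×ˢ Set.Ioo (-π) π

lemma polarCoord_symm_eq_circleMap (p : ℝ × ℝ) :
    Complex.polarCoord.symm p = circleMap 0 p.1 p.2 := by
  rw [Complex.polarCoord_symm_apply, circleMap_zero, Complex.exp_mul_I, Complex.ofReal_cos,
    Complex.ofReal_sin]

lemma integral_eq_polar {E : Type*} [NormedAddCommGroup E] [NormedSpace ℝ E] (f : ℂ → E) :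
    ∫ z, f z = ∫ p in polarDomain, p.1 • f (circleMap 0 p.1 p.2) := by
  rw [← Complex.integral_comp_polarCoord_symm]
  simp only [polarCoord_symm_eq_circleMap]
  rfl

lemma integrableOn_polar {E : Type*} [NormedAddCommGroup E] [NormedSpace ℝ E] {f : ℂ → E}
    (hf : Integrable f) :
    IntegrableOn (fun p : ℝ × ℝ => p.1 • f (circleMap 0 p.1 p.2)) polarDomain := by
  have h1 : Integrable (fun p : ℝ × ℝ => f (Complex.measurableEquivRealProd.symm p)) :=
    (Complex.volume_preserving_equiv_real_prod.symm.integrable_comp_emb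
      Complex.measurableEquivRealProd.symm.measurableEmbedding).2 hf
  have h2 := (integrableOn_image_iff_integrableOn_abs_det_fderiv_smul volume
    (polarCoord.open_target.measurableSet)
    (fun p _ ↦ (hasFDerivAt_polarCoord_symm p).hasFDerivWithinAt) polarCoord.symm.injOn
    (fun p : ℝ × ℝ => f (Complex.measurableEquivRealProd.symm p))).1 h1.integrableOn
  refine h2.congr_fun (fun p hp => ?_) polarCoord.open_target.measurableSet
  have hp1 : 0 < p.1 := hp.1
  simp only [det_fderivPolarCoordSymm, abs_of_pos hp1]
  rw [Complex.measurableEquivRealProd_symm_polarCoord_symm_apply, polarCoord_symm_eq_circleMap]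

lemma integral_Ioo_eq_circleAverage {E : Type*} [NormedAddCommGroup E] [NormedSpace ℝ E]
    (f : ℂ → E) (r : ℝ) :
    ∫ θ in Set.Ioo (-π) π, f (circleMap 0 r θ) = (2 * π) • circleAverage f 0 r := by
  have hp := ((periodic_circleMap 0 r).comp f).intervalIntegral_add_eq (-π) 0
  rw [circleAverage_def, smul_smul, mul_inv_cancel₀ (by positivity), one_smul,
    ← integral_Ioc_eq_integral_Ioo, ← intervalIntegral.integral_of_le (by linarith [pi_pos])]
  simp only [Function.comp_def] at hp
  rw [show -π + 2 * π = π by ring, zero_add] at hp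
  exact hp

lemma integrableOn_circleAverage {E : Type*} [NormedAddCommGroup E] [NormedSpace ℝ E] {f : ℂ → E}
    (hf : Integrable f) :
    IntegrableOn (fun r : ℝ => (2 * π * r) • circleAverage f 0 r) (Set.Ioi 0) := by
  have h := integrableOn_polar hf
  rw [polarDomain, IntegrableOn, Measure.volume_eq_prod, ← Measure.prod_restrict] at h
  refine h.integral_prod_left.congr (ae_of_all _ fun r => ?_)
  simp only
  rw [integral_smul, integral_Ioo_eq_circleAverage, smul_smul, mul_comm]

lemma integral_eq_integral_circleAverage {E : Type*} [NormedAddCommGroup E] [NormedSpace ℝ E]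
    {f : ℂ → E} (hf : Integrable f) :
    ∫ z, f z = ∫ r in Set.Ioi (0 : ℝ), (2 * π * r) • circleAverage f 0 r := by
  have h := integrableOn_polar hf
  rw [integral_eq_polar]
  rw [polarDomain, IntegrableOn, Measure.volume_eq_prod, ← Measure.prod_restrict] at *
  rw [integral_prod _ h]
  refine integral_congr_ae (ae_of_all _ fun r => ?_)
  simp only
  rw [integral_smul, integral_Ioo_eq_circleAverage, smul_smul, mul_comm]

lemma circleAverage_indicator_ball {E : Type*} [NormedAddCommGroup E] [NormedSpace ℝ E]
    (f : ℂ → E) {ρ r : ℝ} (hr : 0 < r) :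
    circleAverage ((Metric.ball 0 ρ).indicator f) 0 r =
      (Set.Iio ρ).indicator (fun r => circleAverage f 0 r) r := by
  by_cases h : r < ρ
  · rw [Set.indicator_of_mem (Set.mem_Iio.2 h)]
    apply circleAverage_congr_sphere
    intro z hz
    rw [mem_sphere_zero_iff_norm, abs_of_pos hr] at hz
    rw [Set.indicator_of_mem]
    simpa [hz] using h
  · rw [Set.indicator_of_notMem (by simpa using h)]
    rw [circleAverage_congr_sphere (f₂ := fun _ => (0 : E))]
    · simp [circleAverage]
    intro z hz
    rw [mem_sphere_zero_iff_norm, abs_of_pos hr] at hz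
    rw [Set.indicator_of_notMem]
    simpa [hz] using h

lemma integrableOn_Ioo_circleAverage {E : Type*} [NormedAddCommGroup E] [NormedSpace ℝ E]
    {f : ℂ → E} {ρ : ℝ} (hf : IntegrableOn f (Metric.ball 0 ρ)) :
    IntegrableOn (fun r : ℝ => (2 * π * r) • circleAverage f 0 r) (Set.Ioo 0 ρ) := by
  have h := integrableOn_circleAverage ((integrable_indicator_iff measurableSet_ball).2 hf)
  refine (h.mono_set Set.Ioo_subset_Ioi_self).congr_fun (fun r hr => ?_) measurableSet_Ioo
  simp only
  rw [circleAverage_indicator_ball _ hr.1, Set.indicator_of_mem (Set.mem_Iio.2 hr.2)]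

lemma setIntegral_ball_eq_circleAverage {E : Type*} [NormedAddCommGroup E] [NormedSpace ℝ E]
    {f : ℂ → E} {ρ : ℝ} (hf : IntegrableOn f (Metric.ball 0 ρ)) :
    ∫ z in Metric.ball 0 ρ, f z = ∫ r in Set.Ioo 0 ρ, (2 * π * r) • circleAverage f 0 r := by
  have h := integral_eq_integral_circleAverage ((integrable_indicator_iff measurableSet_ball).2 hf)
  rw [integral_indicator measurableSet_ball] at h
  rw [h, ← Set.Ioi_inter_Iio, ← setIntegral_indicator measurableSet_Iio]
  refine setIntegral_congr_fun measurableSet_Ioi fun r hr => ?_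
  rw [circleAverage_indicator_ball _ hr]
  by_cases h : r ∈ Set.Iio ρ
  · rw [Set.indicator_of_mem h, Set.indicator_of_mem h]
  · rw [Set.indicator_of_notMem h, Set.indicator_of_notMem h, smul_zero]

/-- Circle means of a product with a radial function. -/
lemma circleAverage_radial_smul {E : Type*} [NormedAddCommGroup E] [NormedSpace ℝ E]
    (f : ℂ → E) (w : ℝ → ℝ) {r : ℝ} (hr : 0 ≤ r) :
    circleAverage (fun z => w ‖z‖ • f z) 0 r = w r • circleAverage f 0 r := by
  rw [← circleAverage_fun_smul]
  apply circleAverage_congr_sphere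
  intro z hz
  rw [mem_sphere_zero_iff_norm, abs_of_nonneg hr] at hz
  simp [hz]

/-- Parseval on the unit circle, applied to `p(rX)`. The index range does not depend on `r`, so that
two radii can be compared term by term. -/
lemma circleAverage_polynomial_sq_norm (p : Polynomial ℂ) (r : ℝ) :
    circleAverage (fun z => ‖p.eval z‖ ^ 2) 0 r =
      ∑ i ∈ Finset.range (p.natDegree + 1), ‖p.coeff i‖ ^ 2 * (r ^ 2) ^ i := by
  set q : Polynomial ℂ := p.comp (Polynomial.C (r : ℂ) * Polynomial.X) with hq
  have h := q.sum_sq_norm_coeff_eq_circleAverage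
  rw [circleAverage_eq_circleAverage_zero_one]
  have e1 : ∀ z : ℂ, q.eval z = p.eval (r * z + 0) := fun z => by simp [hq]
  simp only [e1] at h
  have e2 : ∀ i, q.coeff i = p.coeff i * (r : ℂ) ^ i := fun i => by
    rw [hq, Polynomial.comp_C_mul_X_coeff]
  have h3 : ∑ i ∈ q.support, ‖q.coeff i‖ ^ 2 =
      ∑ i ∈ Finset.range (p.natDegree + 1), ‖q.coeff i‖ ^ 2 := by
    apply Finset.sum_subset
    · intro i hi
      rw [Polynomial.mem_support_iff, e2] at hi
      rw [Finset.mem_range, Nat.lt_succ_iff]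
      exact Polynomial.le_natDegree_of_ne_zero (left_ne_zero_of_mul hi)
    · intro i _ hi
      rw [Polynomial.notMem_support_iff] at hi
      simp [hi]
  rw [h3] at h
  rw [← h]
  refine Finset.sum_congr rfl fun i _ => ?_
  rw [e2, norm_mul, norm_pow, Complex.norm_real, mul_pow, ← pow_mul, ← pow_mul, mul_comm i 2,
    pow_mul, Real.norm_eq_abs, sq_abs, pow_mul]

end Bergman

/-! ### Monotone circle means and pointwise growth of Bergman functions. -/

namespace Bergman

/-- For polynomials the mean is a power series in `r²` with nonnegative coefficients. The general
case is the limit along Taylor partial sums. This monotonicity is what makes `z²` extremal in the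
final estimate. -/
lemma circleAverage_sq_norm_mono {h : ℂ → ℂ} (hh : DifferentiableOn ℂ h (Metric.ball 0 1))
    {r R : ℝ} (hr : 0 ≤ r) (hrR : r ≤ R) (hR : R < 1) :
    circleAverage (fun z => ‖h z‖ ^ 2) 0 r ≤ circleAverage (fun z => ‖h z‖ ^ 2) 0 R := by
  -- The Taylor series converges on radius `ρ`, hence uniformly on the smaller ball of radius `ρ'`,
  -- which still contains the circles of radius at most `R`.
  obtain ⟨ρ, hRρ, hρ⟩ := exists_between hR
  obtain ⟨ρ', hRρ', hρ'⟩ := exists_between hRρ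
  have hρ0 : 0 < ρ := by linarith
  have hρ'0 : 0 < ρ' := by linarith
  lift ρ to NNReal using hρ0.le
  lift ρ' to NNReal using hρ'0.le
  have hps := (hh.mono (Metric.closedBall_subset_ball hρ)).hasFPowerSeriesOnBall
    (NNReal.coe_pos.1 hρ0)
  set p := cauchyPowerSeries h 0 ρ
  have hunif := hps.tendstoUniformlyOn (r' := ρ') (by exact_mod_cast hρ')
  simp only [zero_add] at hunif
  let q : ℕ → Polynomial ℂ := fun n =>
    ∑ k ∈ Finset.range n, Polynomial.C (p.coeff k) * Polynomial.X ^ k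
  have hq : ∀ n z, (q n).eval z = p.partialSum n z := fun n z => by
    simp only [q, Polynomial.eval_finsetSum, FormalMultilinearSeries.partialSum,
      FormalMultilinearSeries.apply_eq_pow_smul_coeff]
    refine Finset.sum_congr rfl fun k _ => ?_
    rw [Polynomial.eval_mul, Polynomial.eval_C, Polynomial.eval_pow, Polynomial.eval_X, smul_eq_mul,
      mul_comm]
  have hball : ∀ t : ℝ, 0 ≤ t → t ≤ R → ∀ θ, circleMap 0 t θ ∈ Metric.ball (0 : ℂ) ρ' := by
    intro t h0 h1 θ
    rw [mem_ball_zero_iff, norm_circleMap_zero, abs_of_nonneg h0]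
    linarith
  obtain ⟨M, hM⟩ := (isCompact_closedBall (0 : ℂ) R).exists_bound_of_continuousOn
    (hh.continuousOn.mono (Metric.closedBall_subset_ball hR))
  have hlim : ∀ t : ℝ, 0 ≤ t → t ≤ R →
      Tendsto (fun n => circleAverage (fun z => ‖(q n).eval z‖ ^ 2) 0 t) atTop
        (𝓝 (circleAverage (fun z => ‖h z‖ ^ 2) 0 t)) := by
    intro t h0 h1
    simp only [circleAverage_def]
    refine Tendsto.const_smul ?_ _
    refine intervalIntegral.tendsto_integral_filter_of_dominated_convergence
      (fun _ => (M + 1) ^ 2) ?_ ?_ ?_ ?_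
    · refine Eventually.of_forall fun n => Continuous.aestronglyMeasurable ?_
      exact (((q n).continuous.comp (continuous_circleMap 0 t)).norm.pow 2)
    · filter_upwards [Metric.tendstoUniformlyOn_iff.1 hunif 1 one_pos] with n hn
      refine ae_of_all _ fun θ _ => ?_
      have h2 := hn _ (hball t h0 h1 θ)
      have h3 := hM (circleMap 0 t θ) (by
        rw [mem_closedBall_zero_iff, norm_circleMap_zero, abs_of_nonneg h0]; exact h1)
      rw [norm_pow, norm_norm, hq]
      rw [dist_comm, dist_eq_norm] at h2
      have h4 := norm_le_norm_add_norm_sub' (p.partialSum n (circleMap 0 t θ)) (h (circleMap 0 t θ))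
      gcongr
      linarith
    · exact intervalIntegrable_const
    · refine ae_of_all _ fun θ _ => ?_
      have h2 := hunif.tendsto_at (hball t h0 h1 θ)
      simp only [hq]
      exact h2.norm.pow 2
  refine le_of_tendsto_of_tendsto' (hlim r hr hrR) (hlim R (hr.trans hrR) le_rfl) fun n => ?_
  rw [circleAverage_polynomial_sq_norm, circleAverage_polynomial_sq_norm]
  gcongr

lemma circleAverage_eq_of_differentiableOn {f : ℂ → ℂ} {c : ℂ} {r R : ℝ}
    (hf : DifferentiableOn ℂ f (Metric.ball c R)) (hr : 0 ≤ r) (hrR : r < R) :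
    circleAverage f c r = f c := by
  apply DiffContOnCl.circleAverage
  rw [abs_of_nonneg hr]
  exact hf.diffContOnCl_ball (Metric.closedBall_subset_ball hrR)

lemma circleIntegrable_of_continuousOn_ball {E : Type*} [NormedAddCommGroup E]
    {f : ℂ → E} {c : ℂ} {r R : ℝ}
    (hf : ContinuousOn f (Metric.ball c R)) (hr : 0 ≤ r) (hrR : r < R) :
    CircleIntegrable f c r := by
  apply ContinuousOn.circleIntegrable hr
  exact hf.mono (Metric.sphere_subset_closedBall.trans (Metric.closedBall_subset_ball hrR))

/-- Area sub-mean value property of `|f|²`. -/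
lemma sq_norm_mul_le_setIntegral_ball {f : ℂ → ℂ} {δ δ' : ℝ} (hδ : 0 < δ) (hδ' : δ < δ')
    (hf : DifferentiableOn ℂ f (Metric.ball 0 δ')) :
    π * δ ^ 2 * ‖f 0‖ ^ 2 ≤ ∫ z in Metric.ball 0 δ, ‖f z‖ ^ 2 := by
  have hintg : IntegrableOn (fun z => ‖f z‖ ^ 2) (Metric.ball 0 δ) := by
    refine IntegrableOn.mono_set ?_ Metric.ball_subset_closedBall
    refine ContinuousOn.integrableOn_compact (isCompact_closedBall _ _) ?_
    exact (hf.continuousOn.mono (Metric.closedBall_subset_ball hδ')).norm.pow 2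
  rw [setIntegral_ball_eq_circleAverage hintg]
  have hpt : ∀ r ∈ Set.Ioo 0 δ, 2 * π * r * ‖f 0‖ ^ 2 ≤
      (2 * π * r) • circleAverage (fun z => ‖f z‖ ^ 2) 0 r := by
    intro r hr
    rw [smul_eq_mul]
    have hr0 : 0 < r := hr.1
    gcongr
    -- The mean value property of the holomorphic function `f²` gives `|f(0)|² = |mean of f²| ≤ mean
    -- of |f|²`.
    have h1 : circleAverage (fun z => f z ^ 2) 0 r = f 0 ^ 2 :=
      circleAverage_eq_of_differentiableOn (hf.pow 2) hr0.le (hr.2.trans hδ')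
    rw [← norm_pow, ← h1, circleAverage_def, circleAverage_def, norm_smul, smul_eq_mul,
      Real.norm_of_nonneg (by positivity)]
    gcongr
    refine (intervalIntegral.norm_integral_le_integral_norm (by positivity)).trans_eq ?_
    simp only [norm_pow]
  have hcalc : ∫ r in Set.Ioo 0 δ, 2 * π * r * ‖f 0‖ ^ 2 = π * δ ^ 2 * ‖f 0‖ ^ 2 := by
    rw [← integral_Ioc_eq_integral_Ioo, ← intervalIntegral.integral_of_le hδ.le,
      intervalIntegral.integral_mul_const, intervalIntegral.integral_const_mul, integral_id]
    ring
  rw [← hcalc]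
  refine setIntegral_mono_on ?_ (integrableOn_Ioo_circleAverage hintg) measurableSet_Ioo hpt
  refine IntegrableOn.mono_set ?_ Set.Ioo_subset_Icc_self
  exact Continuous.integrableOn_Icc (by fun_prop)

/-- The weight `(1 - |z|²)^β`. -/
def weight (β : ℝ) (z : ℂ) : ℝ := (1 - ‖z‖ ^ 2) ^ β

lemma one_sub_sq_pos {z : ℂ} (hz : z ∈ disk) : 0 < 1 - ‖z‖ ^ 2 := by
  rw [disk, mem_ball_zero_iff] at hz
  nlinarith [norm_nonneg z]

lemma weight_pos (β : ℝ) {z : ℂ} (hz : z ∈ disk) : 0 < weight β z :=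
  rpow_pos_of_pos (one_sub_sq_pos hz) _

lemma continuousOn_weight (β : ℝ) : ContinuousOn (weight β) disk := by
  unfold weight
  refine ContinuousOn.rpow_const (by fun_prop) fun z hz => Or.inl (one_sub_sq_pos hz).ne'

lemma isOpen_disk : IsOpen disk := Metric.isOpen_ball

lemma measurableSet_disk : MeasurableSet disk := isOpen_disk.measurableSet

/-- Pointwise growth of functions of the Bergman space. -/
lemma exists_growth_bound {α : ℝ} {g : ℂ → ℂ} (hg : g ∈ space α) :
    ∃ C, 0 ≤ C ∧ ∀ z ∈ disk, ‖g z‖ ^ 2 * (1 - ‖z‖ ^ 2) ^ (α + 2) ≤ C := by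
  obtain ⟨hd, hi⟩ := hg
  set T := ∫ z in disk, ‖g z‖ ^ 2 * (1 - ‖z‖ ^ 2) ^ α with hT
  -- On the ball of radius `d / 2` about `z`, `d = 1 - |z|`, the quantity `1 - |·|²` lies between `d
  -- / 2` and `3 d`. The minimum and the maximum cover both signs of the exponents `α` and `α + 2`.
  set m : ℝ := min ((1 / 2 : ℝ) ^ α) (3 ^ α) with hm
  set m' : ℝ := max (1 : ℝ) (2 ^ (α + 2)) with hm'
  have hm0 : 0 < m := lt_min (by positivity) (by positivity)
  have hT0 : 0 ≤ T := setIntegral_nonneg measurableSet_disk fun z hz => by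
    have := one_sub_sq_pos hz
    positivity
  have hm'0 : 0 ≤ m' := le_max_of_le_left zero_le_one
  refine ⟨4 * T / (π * m) * m', by positivity, fun z hz => ?_⟩
  have hz1 : ‖z‖ < 1 := by simpa [disk] using hz
  set d := 1 - ‖z‖ with hd'
  have hd0 : 0 < d := by linarith
  have hnb : ∀ w ∈ Metric.ball (0 : ℂ) (d / 2), d / 2 ≤ 1 - ‖z + w‖ ^ 2 ∧ 1 - ‖z + w‖ ^ 2 ≤ 3 * d := by
    intro w hw
    rw [mem_ball_zero_iff] at hw
    have h1 := norm_add_le z w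
    have h2 := norm_sub_le_norm_add z w
    have h3 := norm_nonneg (z + w)
    constructor <;> nlinarith
  have hsub : ∀ w ∈ Metric.ball (0 : ℂ) d, z + w ∈ disk := by
    intro w hw
    rw [mem_ball_zero_iff] at hw
    rw [disk, mem_ball_zero_iff]
    linarith [norm_add_le z w]
  have hdiff : DifferentiableOn ℂ (fun w => g (z + w)) (Metric.ball 0 d) :=
    hd.comp (by fun_prop) hsub
  have h1 := sq_norm_mul_le_setIntegral_ball (half_pos hd0) (half_lt_self hd0) hdiff
  simp only [add_zero] at h1
  have hcmp : ∀ w ∈ Metric.ball (0 : ℂ) (d / 2), m * d ^ α ≤ (1 - ‖z + w‖ ^ 2) ^ α := by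
    intro w hw
    obtain ⟨ha, hb⟩ := hnb w hw
    rcases le_total 0 α with h | h
    · calc m * d ^ α ≤ (1 / 2) ^ α * d ^ α := by gcongr; exact min_le_left _ _
        _ = (d / 2) ^ α := by rw [← mul_rpow (by norm_num) hd0.le]; congr 1; ring
        _ ≤ _ := by gcongr
    · calc m * d ^ α ≤ 3 ^ α * d ^ α := by gcongr; exact min_le_right _ _
        _ = (3 * d) ^ α := by rw [← mul_rpow (by norm_num) hd0.le]
        _ ≤ _ := rpow_le_rpow_of_nonpos (by linarith) hb h
  have h2 : m * d ^ α * ∫ w in Metric.ball (0 : ℂ) (d / 2), ‖g (z + w)‖ ^ 2 ≤ T := by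
    have hi' : IntegrableOn (fun w => ‖g (z + w)‖ ^ 2 * (1 - ‖z + w‖ ^ 2) ^ α)
        (Metric.ball 0 (d / 2)) := by
      have := ((integrable_indicator_iff measurableSet_disk).2 hi).comp_add_left z
      refine this.integrableOn.congr_fun (fun w hw => ?_) measurableSet_ball
      simp only
      rw [Set.indicator_of_mem (hsub w (Metric.ball_subset_ball (by linarith) hw))]
    rw [← integral_const_mul]
    calc ∫ w in Metric.ball (0 : ℂ) (d / 2), m * d ^ α * ‖g (z + w)‖ ^ 2
        ≤ ∫ w in Metric.ball (0 : ℂ) (d / 2), ‖g (z + w)‖ ^ 2 * (1 - ‖z + w‖ ^ 2) ^ α := by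
          refine setIntegral_mono_on ?_ hi' measurableSet_ball fun w hw => ?_
          · refine IntegrableOn.mono_set ?_ Metric.ball_subset_closedBall
            refine ContinuousOn.integrableOn_compact (isCompact_closedBall _ _) ?_
            exact continuousOn_const.mul ((hdiff.continuousOn.mono
              (Metric.closedBall_subset_ball (half_lt_self hd0))).norm.pow 2)
          · rw [mul_comm]
            gcongr
            exact hcmp w hw
      _ ≤ ∫ w, disk.indicator (fun z => ‖g z‖ ^ 2 * (1 - ‖z‖ ^ 2) ^ α) (z + w) := by
          rw [← integral_indicator measurableSet_ball]
          refine integral_mono_of_nonneg ?_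
            (((integrable_indicator_iff measurableSet_disk).2 hi).comp_add_left z) ?_
          · refine ae_of_all _ fun w => Set.indicator_nonneg (fun w hw => ?_) w
            have := hnb w hw
            have : 0 ≤ 1 - ‖z + w‖ ^ 2 := by linarith
            positivity
          · refine ae_of_all _ fun w => ?_
            by_cases hw : w ∈ Metric.ball (0 : ℂ) (d / 2)
            · simp only
              rw [Set.indicator_of_mem hw,
                Set.indicator_of_mem (hsub w (Metric.ball_subset_ball (by linarith) hw))]
            · rw [Set.indicator_of_notMem hw]
              refine Set.indicator_nonneg (fun w hw => ?_) _
              have := one_sub_sq_pos hw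
              positivity
      _ = T := by
          rw [integral_add_left_eq_self, integral_indicator measurableSet_disk]
  have hdα : 0 < d ^ α := by positivity
  have h3 : ‖g z‖ ^ 2 * d ^ (α + 2) ≤ 4 * T / (π * m) := by
    rw [le_div_iff₀ (by positivity), rpow_add hd0, rpow_two]
    calc ‖g z‖ ^ 2 * (d ^ α * d ^ 2) * (π * m)
        = 4 * (m * d ^ α * (π * (d / 2) ^ 2 * ‖g z‖ ^ 2)) := by ring
      _ ≤ 4 * (m * d ^ α * ∫ w in Metric.ball (0 : ℂ) (d / 2), ‖g (z + w)‖ ^ 2) := by gcongr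
      _ ≤ 4 * T := by gcongr
  have h4 : (1 - ‖z‖ ^ 2) ^ (α + 2) ≤ d ^ (α + 2) * m' := by
    have ha : d ≤ 1 - ‖z‖ ^ 2 := by nlinarith [norm_nonneg z]
    have hb : 1 - ‖z‖ ^ 2 ≤ 2 * d := by nlinarith [norm_nonneg z]
    have : 0 ≤ d ^ (α + 2) := by positivity
    rcases le_total 0 (α + 2) with h | h
    · calc (1 - ‖z‖ ^ 2) ^ (α + 2) ≤ (2 * d) ^ (α + 2) :=
          rpow_le_rpow (by linarith) hb h
        _ = d ^ (α + 2) * 2 ^ (α + 2) := by rw [mul_rpow (by norm_num) hd0.le, mul_comm]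
        _ ≤ _ := by gcongr; exact le_max_right _ _
    · calc (1 - ‖z‖ ^ 2) ^ (α + 2) ≤ d ^ (α + 2) := rpow_le_rpow_of_nonpos hd0 ha h
        _ = d ^ (α + 2) * 1 := by ring
        _ ≤ _ := by gcongr; exact le_max_left _ _
  calc ‖g z‖ ^ 2 * (1 - ‖z‖ ^ 2) ^ (α + 2) ≤ ‖g z‖ ^ 2 * (d ^ (α + 2) * m') := by gcongr
    _ = ‖g z‖ ^ 2 * d ^ (α + 2) * m' := by ring
    _ ≤ _ := by gcongr

end Bergman

/-! ### Radial integrals, the orthogonality conditions and the norm of the perturbation. -/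

namespace Bergman

/-- Fundamental theorem of calculus for a nonnegative derivative. -/
lemma integrableOn_and_integral_Ioo_of_hasDerivAt {F f : ℝ → ℝ} {a b : ℝ} (hab : a ≤ b)
    (hc : ContinuousOn F (Set.Icc a b)) (hd : ∀ x ∈ Set.Ioo a b, HasDerivAt F (f x) x)
    (hf : ∀ x ∈ Set.Ioo a b, 0 ≤ f x) :
    IntegrableOn f (Set.Ioo a b) ∧ ∫ x in Set.Ioo a b, f x = F b - F a := by
  -- The sign of `f` makes integrability automatic. This matters at `r = 1`, where the weight is
  -- unbounded for `α < 0`.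
  have h := intervalIntegral.integrableOn_deriv_of_nonneg hc hd hf
  refine ⟨h.mono_set Set.Ioo_subset_Ioc_self, ?_⟩
  rw [← integral_Ioc_eq_integral_Ioo, ← intervalIntegral.integral_of_le hab]
  exact intervalIntegral.integral_eq_sub_of_hasDerivAt_of_le hab hc hd
    ((intervalIntegrable_iff_integrableOn_Ioc_of_le hab).2 h)

lemma hasDerivAt_one_sub_sq_rpow (β : ℝ) {r : ℝ} (hr : r ∈ Set.Ioo (0 : ℝ) 1) :
    HasDerivAt (fun r : ℝ => (1 - r ^ 2) ^ β) (-(2 * r) * β * (1 - r ^ 2) ^ (β - 1)) r := by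
  have h1 : HasDerivAt (fun r : ℝ => 1 - r ^ 2) (-(2 * r)) r := by
    simpa using (hasDerivAt_pow 2 r).const_sub 1
  exact h1.rpow_const (Or.inl (by nlinarith [hr.1, hr.2]))

lemma continuous_one_sub_sq_rpow {β : ℝ} (hβ : 0 ≤ β) :
    Continuous (fun r : ℝ => (1 - r ^ 2) ^ β) :=
  Continuous.rpow_const (by fun_prop) fun _ => Or.inr hβ

lemma radial_weight_integral {α : ℝ} (hα : -1 < α) {ρ : ℝ} (h0 : 0 ≤ ρ) (h1 : ρ ≤ 1) :
    IntegrableOn (fun r : ℝ => r * (1 - r ^ 2) ^ α) (Set.Ioo 0 ρ) ∧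
      ∫ r in Set.Ioo 0 ρ, r * (1 - r ^ 2) ^ α = (1 - (1 - ρ ^ 2) ^ (α + 1)) / (2 * (α + 1)) := by
  have hα1 : α + 1 ≠ 0 := by linarith
  have h := integrableOn_and_integral_Ioo_of_hasDerivAt (F := fun r : ℝ =>
    -((1 - r ^ 2) ^ (α + 1)) / (2 * (α + 1))) (f := fun r => r * (1 - r ^ 2) ^ α) h0
    ((continuous_one_sub_sq_rpow (by linarith)).neg.div_const _).continuousOn
    (fun r hr => by
      have h2 := ((hasDerivAt_one_sub_sq_rpow (α + 1) (r := r) ⟨hr.1, hr.2.trans_le h1⟩).neg).div_const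
        (2 * (α + 1))
      convert! h2 using 1
      rw [add_sub_cancel_right]
      field_simp)
    (fun r hr => by
      have hr0 := hr.1
      have : 0 < 1 - r ^ 2 := by nlinarith [hr.1, hr.2]
      positivity)
  refine ⟨h.1, h.2.trans ?_⟩
  simp only [ne_eq, OfNat.ofNat_ne_zero, not_false_eq_true, zero_pow, sub_zero, one_rpow]
  ring

lemma radial_weight_integral_pow_five {α : ℝ} (hα : -1 < α) {ρ : ℝ} (h0 : 0 ≤ ρ) (h1 : ρ ≤ 1) :
    IntegrableOn (fun r : ℝ => r ^ 5 * (1 - r ^ 2) ^ α) (Set.Ioo 0 ρ) ∧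
      ∫ r in Set.Ioo 0 ρ, r ^ 5 * (1 - r ^ 2) ^ α =
        ((1 - (1 - ρ ^ 2) ^ (α + 1)) / (α + 1) - 2 * (1 - (1 - ρ ^ 2) ^ (α + 2)) / (α + 2)
          + (1 - (1 - ρ ^ 2) ^ (α + 3)) / (α + 3)) / 2 := by
  have hα1 : α + 1 ≠ 0 := by linarith
  have hα2 : α + 2 ≠ 0 := by linarith
  have hα3 : α + 3 ≠ 0 := by linarith
  -- The antiderivative comes from `r⁵ = r (1 - 2x + x²)` with `x = 1 - r²`.
  have h := integrableOn_and_integral_Ioo_of_hasDerivAt (F := fun r : ℝ =>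
    -((1 - r ^ 2) ^ (α + 1) / (α + 1) - 2 * (1 - r ^ 2) ^ (α + 2) / (α + 2)
      + (1 - r ^ 2) ^ (α + 3) / (α + 3)) / 2) (f := fun r => r ^ 5 * (1 - r ^ 2) ^ α) h0
    (by
      have e1 := continuous_one_sub_sq_rpow (β := α + 1) (by linarith)
      have e2 := continuous_one_sub_sq_rpow (β := α + 2) (by linarith)
      have e3 := continuous_one_sub_sq_rpow (β := α + 3) (by linarith)
      exact ((((e1.div_const _).sub ((e2.const_mul 2).div_const _)).add
        (e3.div_const _)).neg.div_const _).continuousOn)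
    (fun r hr => by
      have hr1 : r ∈ Set.Ioo (0 : ℝ) 1 := ⟨hr.1, hr.2.trans_le h1⟩
      have hpos : 0 < 1 - r ^ 2 := by nlinarith [hr1.1, hr1.2]
      have e1 := hasDerivAt_one_sub_sq_rpow (α + 1) hr1
      have e2 := hasDerivAt_one_sub_sq_rpow (α + 2) hr1
      have e3 := hasDerivAt_one_sub_sq_rpow (α + 3) hr1
      have h2 := ((((e1.div_const (α + 1)).sub ((e2.const_mul 2).div_const (α + 2))).add
        (e3.div_const (α + 3))).neg.div_const 2)
      convert! h2 using 1
      rw [add_sub_cancel_right, show α + 2 - 1 = α + 1 by ring, show α + 3 - 1 = α + 2 by ring,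
        rpow_add hpos, rpow_add hpos, rpow_one, rpow_two]
      field_simp
      ring)
    (fun r hr => by
      have hr0 := hr.1
      have : 0 < 1 - r ^ 2 := by nlinarith [hr.1, hr.2]
      positivity)
  refine ⟨h.1, h.2.trans ?_⟩
  simp only [ne_eq, OfNat.ofNat_ne_zero, not_false_eq_true, zero_pow, sub_zero, one_rpow]
  ring

lemma integrableOn_weight {α : ℝ} (hα : -1 < α) : IntegrableOn (weight α) disk := by
  have h := (radial_weight_integral hα zero_le_one le_rfl).1
  have := (integrableOn_fun_norm_addHaar (E := ℂ) volume (f := fun r : ℝ => (1 - r ^ 2) ^ α)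
    (r := 1)).2 (by simpa using h)
  exact this

lemma circleAverage_weight_mul (f : ℂ → ℝ) (β : ℝ) {r : ℝ} (hr : 0 ≤ r) :
    circleAverage (fun z => f z * weight β z) 0 r = (1 - r ^ 2) ^ β * circleAverage f 0 r := by
  have := circleAverage_radial_smul f (fun r => (1 - r ^ 2) ^ β) hr
  simp only [smul_eq_mul] at this
  rw [← this]
  simp only [weight, mul_comm]

lemma circleAverage_weight_mul_complex (f : ℂ → ℂ) (β : ℝ) {r : ℝ} (hr : 0 ≤ r) :
    circleAverage (fun z => f z * (weight β z : ℂ)) 0 r =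
      ((1 - r ^ 2) ^ β : ℝ) * circleAverage f 0 r := by
  have := circleAverage_radial_smul f (fun r => (1 - r ^ 2) ^ β) hr
  simp only [Complex.real_smul] at this
  rw [← this]
  simp only [weight, mul_comm]

lemma integral_weight_ball {α : ℝ} (hα : -1 < α) {ρ : ℝ} (h0 : 0 ≤ ρ) (h1 : ρ ≤ 1) :
    ∫ z in Metric.ball 0 ρ, weight α z = π * (1 - (1 - ρ ^ 2) ^ (α + 1)) / (α + 1) := by
  have hi : IntegrableOn (weight α) (Metric.ball 0 ρ) :=
    (integrableOn_weight hα).mono_set (Metric.ball_subset_ball h1)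
  rw [setIntegral_ball_eq_circleAverage hi]
  have : ∀ r ∈ Set.Ioo 0 ρ, (2 * π * r) • circleAverage (weight α) 0 r =
      2 * π * (r * (1 - r ^ 2) ^ α) := by
    intro r hr
    have := circleAverage_weight_mul (fun _ => 1) α hr.1.le
    simp only [one_mul, circleAverage_const, mul_one] at this
    rw [show weight α = fun z => weight α z from rfl, this, smul_eq_mul]
    ring
  rw [setIntegral_congr_fun measurableSet_Ioo this, integral_const_mul,
    (radial_weight_integral hα h0 h1).2]
  have hα1 : α + 1 ≠ 0 := by linarith
  field_simp

/-- Integrability of `h · weight` for `h` dominated by an element of the Bergman space. -/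
lemma integrableOn_mul_weight {α : ℝ} (hα : -1 < α) {g : ℂ → ℂ} (hg : g ∈ space α) {h : ℂ → ℂ}
    (hh : ContinuousOn h disk) (hb : ∀ z ∈ disk, ‖h z‖ ≤ ‖g z‖) :
    IntegrableOn (fun z => h z * (weight α z : ℂ)) disk := by
  -- The domination is `|h| ≤ |g| ≤ |g|² + 1`, and the weight itself is integrable because `α > -1`.
  have hdom : IntegrableOn (fun z => ‖g z‖ ^ 2 * (1 - ‖z‖ ^ 2) ^ α + weight α z) disk :=
    hg.2.add (integrableOn_weight hα)
  refine hdom.mono' (ContinuousOn.aestronglyMeasurable ?_ measurableSet_disk) ?_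
  · exact hh.mul (Complex.continuous_ofReal.comp_continuousOn (continuousOn_weight α))
  · refine (ae_restrict_iff' measurableSet_disk).2 (ae_of_all _ fun z hz => ?_)
    have hw := weight_pos α hz
    rw [norm_mul, Complex.norm_real, Real.norm_of_nonneg hw.le]
    change _ ≤ ‖g z‖ ^ 2 * weight α z + weight α z
    rw [← add_one_mul]
    gcongr
    nlinarith [hb z hz, sq_nonneg (‖g z‖ - 1), norm_nonneg (g z)]

/-- If `h = |z|^(2k) q` with `q` holomorphic, then the weighted integral of `h` is a positive
multiple of `q 0`. -/
lemma eq_zero_of_integral_eq_zero {α : ℝ} {h q : ℂ → ℂ} {k : ℕ}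
    (hq : DifferentiableOn ℂ q disk) (hhq : ∀ z ∈ disk, h z = ((‖z‖ ^ (2 * k) : ℝ) : ℂ) * q z)
    (hi : IntegrableOn (fun z => h z * (weight α z : ℂ)) disk)
    (hintg : IntegrableOn (fun r : ℝ => r ^ (2 * k + 1) * (1 - r ^ 2) ^ α) (Set.Ioo 0 1))
    (h0 : ∫ z in disk, h z * (weight α z : ℂ) = 0) : q 0 = 0 := by
  rw [disk, setIntegral_ball_eq_circleAverage hi] at h0
  have e : ∀ r ∈ Set.Ioo (0 : ℝ) 1, (2 * π * r) • circleAverage (fun z => h z * (weight α z : ℂ)) 0 r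
      = ((r ^ (2 * k + 1) * (1 - r ^ 2) ^ α : ℝ) : ℂ) * (2 * π * q 0) := by
    intro r hr
    have e1 : circleAverage h 0 r = ((r ^ (2 * k) : ℝ) : ℂ) * q 0 := by
      rw [← circleAverage_eq_of_differentiableOn hq hr.1.le hr.2, ← Complex.real_smul,
        ← circleAverage_fun_smul]
      apply circleAverage_congr_sphere
      intro z hz
      rw [mem_sphere_zero_iff_norm, abs_of_pos hr.1] at hz
      simp only
      rw [hhq z (by rw [disk, mem_ball_zero_iff, hz]; exact hr.2), hz, Complex.real_smul]
    rw [circleAverage_weight_mul_complex _ _ hr.1.le, e1, Complex.real_smul]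
    push_cast
    ring
  rw [setIntegral_congr_fun measurableSet_Ioo e, integral_mul_const, integral_complex_ofReal] at h0
  have hpos : 0 < ∫ r in Set.Ioo (0 : ℝ) 1, r ^ (2 * k + 1) * (1 - r ^ 2) ^ α := by
    have hp : ∀ r ∈ Set.Ioo (0 : ℝ) 1, 0 < r ^ (2 * k + 1) * (1 - r ^ 2) ^ α := by
      intro r hr
      have h1 := hr.1
      have : 0 < 1 - r ^ 2 := by nlinarith [hr.1, hr.2]
      positivity
    rw [setIntegral_pos_iff_support_of_nonneg_ae
      ((ae_restrict_iff' measurableSet_Ioo).2 (ae_of_all _ fun r hr => (hp r hr).le)) hintg]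
    have : Set.Ioo (0 : ℝ) 1 ⊆
        Function.support (fun r : ℝ => r ^ (2 * k + 1) * (1 - r ^ 2) ^ α) ∩ Set.Ioo 0 1 :=
      fun r hr => ⟨(hp r hr).ne', hr⟩
    refine lt_of_lt_of_le ?_ (measure_mono this)
    simp
  rcases mul_eq_zero.1 h0 with h | h
  · exact absurd (Complex.ofReal_eq_zero.1 h) hpos.ne'
  · simpa [pi_ne_zero] using h

lemma dslope_mul {f : ℂ → ℂ} (h0 : f 0 = 0) (z : ℂ) : f z = z * dslope f 0 z := by
  have := sub_smul_dslope f 0 z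
  simpa [h0] using this.symm

/-- An element of the Bergman space orthogonal to `1` and `z` vanishes to second order at `0`. -/
lemma exists_eq_sq_mul {α : ℝ} (hα : -1 < α) {g : ℂ → ℂ} (hg : g ∈ space α)
    (hg_one : scalar α g (fun _ => 1) = 0) (hg_id : scalar α g (fun z => z) = 0) :
    ∃ h : ℂ → ℂ, DifferentiableOn ℂ h disk ∧ ∀ z, g z = z ^ 2 * h z := by
  have hd : disk ∈ 𝓝 (0 : ℂ) := isOpen_disk.mem_nhds (by simp [disk])
  have hintg := (radial_weight_integral hα zero_le_one le_rfl).1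
  have h0 : g 0 = 0 := by
    refine eq_zero_of_integral_eq_zero (α := α) (h := g) (k := 0) hg.1 (fun z _ => by simp)
      (integrableOn_mul_weight hα hg hg.1.continuousOn fun _ _ => le_rfl) (by simpa using hintg) ?_
    simpa [scalar, weight] using hg_one
  -- Since `g = z g₁`, the integrand of `⟨g, z⟩` is `|z|² g₁` times the weight. Orthogonality to `z`
  -- thus forces `g₁(0) = 0`, just as orthogonality to `1` forced `g(0) = 0`.
  set g₁ := dslope g 0
  have hg₁ : DifferentiableOn ℂ g₁ disk := (Complex.differentiableOn_dslope hd).2 hg.1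
  have h1 : g₁ 0 = 0 := by
    refine eq_zero_of_integral_eq_zero (α := α) (h := fun z => g z * (starRingEnd ℂ) z) (k := 1)
      hg₁ (fun z _ => ?_) ?_ ?_ ?_
    · rw [dslope_mul h0 z, mul_right_comm, Complex.mul_conj, Complex.normSq_eq_norm_sq, mul_one]
    · refine integrableOn_mul_weight hα hg
        (hg.1.continuousOn.mul Complex.continuous_conj.continuousOn) fun z hz => ?_
      rw [norm_mul, RCLike.norm_conj]
      rw [disk, mem_ball_zero_iff] at hz
      exact mul_le_of_le_one_right (norm_nonneg _) hz.le
    · refine hintg.mono' (by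
        refine ContinuousOn.aestronglyMeasurable ?_ measurableSet_Ioo
        refine ContinuousOn.mul (by fun_prop) (ContinuousOn.rpow_const (by fun_prop) fun r hr => ?_)
        left
        have : 0 < 1 - r ^ 2 := by nlinarith [hr.1, hr.2]
        exact this.ne') ?_
      refine (ae_restrict_iff' measurableSet_Ioo).2 (ae_of_all _ fun r hr => ?_)
      have hr0 := hr.1
      have : 0 < 1 - r ^ 2 := by nlinarith [hr.1, hr.2]
      rw [Real.norm_of_nonneg (by positivity)]
      gcongr
      exact pow_le_of_le_one hr0.le hr.2.le (by norm_num)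
    · simpa [scalar, weight] using hg_id
  refine ⟨dslope g₁ 0, (Complex.differentiableOn_dslope hd).2 hg₁, fun z => ?_⟩
  rw [dslope_mul h0 z, show dslope g 0 z = z * dslope g₁ 0 z from dslope_mul h1 z]
  ring

/-- The constant `√((α + 1) / π)`. -/
def c₀ (α : ℝ) : ℝ := √((α + 1) / π)

lemma c₀_pos {α : ℝ} (hα : -1 < α) : 0 < c₀ α :=
  sqrt_pos.2 (div_pos (by linarith) pi_pos)

lemma c₀_sq {α : ℝ} (hα : -1 < α) : c₀ α ^ 2 = (α + 1) / π :=
  sq_sqrt (div_pos (by linarith) pi_pos).le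

/-- The perturbation `f₀ + ε g`. -/
def pert (α : ℝ) (g : ℂ → ℂ) (ε : ℝ) (z : ℂ) : ℂ := f₀ α z + (ε : ℂ) * g z

lemma sq_norm_pert (α : ℝ) (g : ℂ → ℂ) (ε : ℝ) (z : ℂ) :
    ‖pert α g ε z‖ ^ 2 = c₀ α ^ 2 + 2 * c₀ α * ε * (g z).re + ε ^ 2 * ‖g z‖ ^ 2 := by
  rw [← Complex.normSq_eq_norm_sq, ← Complex.normSq_eq_norm_sq, Complex.normSq_apply,
    Complex.normSq_apply]
  simp only [pert, f₀, c₀, Complex.add_re, Complex.ofReal_re, Complex.mul_re, Complex.ofReal_im,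
    zero_mul, sub_zero, Complex.add_im, Complex.mul_im, add_zero, zero_add]
  ring

lemma sq_norm_eq {α : ℝ} (f : ℂ → ℂ) : norm α f ^ 2 = ∫ z in disk, ‖f z‖ ^ 2 * weight α z := by
  refine sq_sqrt (setIntegral_nonneg measurableSet_disk fun z hz => ?_)
  have := one_sub_sq_pos hz
  positivity

/-- The cross term is a multiple of `Re ⟨g, 1⟩ = 0`, and `f₀` and `g` are unit vectors. -/
lemma norm_pert_sq {α : ℝ} (hα : -1 < α) {g : ℂ → ℂ} (hg : g ∈ space α) (hnorm : norm α g = 1)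
    (hg_one : scalar α g (fun _ => 1) = 0) (ε : ℝ) : norm α (pert α g ε) ^ 2 = 1 + ε ^ 2 := by
  have hi := integrableOn_mul_weight hα hg hg.1.continuousOn fun _ _ => le_rfl
  have hre : ∀ z, (g z * (weight α z : ℂ)).re = (g z).re * weight α z := fun z => by simp
  have hi_re : IntegrableOn (fun z => (g z).re * weight α z) disk := by
    have := Complex.reCLM.integrable_comp hi
    simpa [hre, IntegrableOn] using this
  have h_re : ∫ z in disk, (g z).re * weight α z = 0 := by
    have h := Complex.reCLM.integral_comp_comm hi
    simp only [Complex.reCLM_apply, hre] at h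
    rw [h]
    have : ∫ z in disk, g z * (weight α z : ℂ) = 0 := by simpa [scalar, weight] using hg_one
    rw [this, Complex.zero_re]
  have h1 : ∫ z in disk, ‖g z‖ ^ 2 * weight α z = 1 := by rw [← sq_norm_eq, hnorm, one_pow]
  have hw := integral_weight_ball hα zero_le_one le_rfl
  rw [one_pow, sub_self, zero_rpow (by linarith)] at hw
  rw [sq_norm_eq]
  have e : ∀ z, ‖pert α g ε z‖ ^ 2 * weight α z = c₀ α ^ 2 * weight α z +
      2 * c₀ α * ε * ((g z).re * weight α z) + ε ^ 2 * (‖g z‖ ^ 2 * weight α z) := fun z => by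
    rw [sq_norm_pert]; ring
  simp only [e]
  have i1 := (integrableOn_weight hα).const_mul (c₀ α ^ 2)
  have i2 := hi_re.const_mul (2 * c₀ α * ε)
  have i3 : IntegrableOn (fun z => ε ^ 2 * (‖g z‖ ^ 2 * weight α z)) disk := hg.2.const_mul (ε ^ 2)
  have i12 : IntegrableOn (fun z => c₀ α ^ 2 * weight α z +
      2 * c₀ α * ε * ((g z).re * weight α z)) disk := i1.add i2
  rw [integral_add i12 i3, integral_add i1 i2, integral_const_mul, integral_const_mul,
    integral_const_mul, h_re, h1, show disk = Metric.ball 0 1 from rfl, hw, c₀_sq hα]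
  have hα1 : α + 1 ≠ 0 := by linarith
  field_simp
  ring

end Bergman

/-! ### Hyperbolic measure, confinement of superlevel sets, and the rearrangement. -/

namespace Bergman

/-- The density of the hyperbolic measure. -/
def density (z : ℂ) : ℝ := ((1 - ‖z‖ ^ 2) ^ 2)⁻¹

lemma measurable_density : Measurable density := by
  unfold density
  fun_prop

lemma density_nonneg (z : ℂ) : 0 ≤ density z := by
  unfold density
  positivity

lemma continuousOn_density : ContinuousOn density disk := by
  unfold density
  exact ContinuousOn.inv₀ (by fun_prop) fun z hz => (pow_pos (one_sub_sq_pos hz) 2).ne'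

lemma hyp_eq : hyp = (volume.restrict disk).withDensity (fun z => ENNReal.ofReal (density z)) := rfl

lemma hyp_absolutelyContinuous : hyp ≪ volume :=
  (withDensity_absolutelyContinuous _ _).trans Measure.absolutelyContinuous_restrict

lemma setIntegral_hyp {E : Set ℂ} (hE : MeasurableSet E) (hED : E ⊆ disk) (ψ : ℂ → ℝ) :
    ∫ z in E, ψ z ∂hyp = ∫ z in E, density z * ψ z := by
  rw [hyp_eq, setIntegral_withDensity_eq_setIntegral_toReal_smul
    measurable_density.ennreal_ofReal (ae_of_all _ fun _ => ENNReal.ofReal_lt_top) _ hE,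
    Measure.restrict_restrict hE, Set.inter_eq_left.2 hED]
  simp only [ENNReal.toReal_ofReal (density_nonneg _), smul_eq_mul]

lemma hyp_apply {E : Set ℂ} (hE : MeasurableSet E) (hED : E ⊆ disk) :
    hyp E = ∫⁻ z in E, ENNReal.ofReal (density z) := by
  rw [hyp_eq, withDensity_apply _ hE, Measure.restrict_restrict hE, Set.inter_eq_left.2 hED]

lemma closedBall_subset_disk {R : ℝ} (hR : R < 1) : Metric.closedBall (0 : ℂ) R ⊆ disk :=
  Metric.closedBall_subset_ball hR

lemma integrableOn_density {R : ℝ} (hR : R < 1) :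
    IntegrableOn density (Metric.closedBall 0 R) :=
  (continuousOn_density.mono (closedBall_subset_disk hR)).integrableOn_compact
    (isCompact_closedBall _ _)

lemma hyp_eq_ofReal {R : ℝ} (hR : R < 1) {E : Set ℂ} (hE : MeasurableSet E)
    (hER : E ⊆ Metric.closedBall 0 R) : hyp E = ENNReal.ofReal (∫ z in E, density z) := by
  rw [hyp_apply hE (hER.trans (closedBall_subset_disk hR)),
    ofReal_integral_eq_lintegral_ofReal ((integrableOn_density hR).mono_set hER)
      (ae_of_all _ density_nonneg)]

lemma hyp_lt_top {R : ℝ} (hR : R < 1) {E : Set ℂ} (hER : E ⊆ Metric.closedBall 0 R) :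
    hyp E < ⊤ := by
  refine (measure_mono hER).trans_lt ?_
  rw [hyp_eq_ofReal hR Metric.isClosed_closedBall.measurableSet le_rfl]
  exact ENNReal.ofReal_lt_top

lemma integral_density_ball {ρ : ℝ} (h0 : 0 ≤ ρ) (h1 : ρ < 1) :
    ∫ z in Metric.ball 0 ρ, density z = π * ρ ^ 2 / (1 - ρ ^ 2) := by
  have hi : IntegrableOn density (Metric.ball 0 ρ) :=
    (integrableOn_density h1).mono_set Metric.ball_subset_closedBall
  have hρ : 0 < 1 - ρ ^ 2 := by nlinarith
  rw [setIntegral_ball_eq_circleAverage hi]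
  have e : ∀ r ∈ Set.Ioo 0 ρ, (2 * π * r) • circleAverage density 0 r =
      2 * π * r / (1 - r ^ 2) ^ 2 := by
    intro r hr
    have : circleAverage density 0 r = ((1 - r ^ 2) ^ 2)⁻¹ := by
      rw [circleAverage_congr_sphere (f₂ := fun _ => ((1 - r ^ 2) ^ 2)⁻¹), circleAverage_const]
      intro z hz
      rw [mem_sphere_zero_iff_norm, abs_of_pos hr.1] at hz
      simp [density, hz]
    rw [this, smul_eq_mul, div_eq_mul_inv]
  rw [setIntegral_congr_fun measurableSet_Ioo e]
  have hne : ∀ r ∈ Set.Icc 0 ρ, (1 - r ^ 2 : ℝ) ≠ 0 := fun r hr => by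
    have : 0 < 1 - r ^ 2 := by nlinarith [hr.1, hr.2]
    exact this.ne'
  rw [(integrableOn_and_integral_Ioo_of_hasDerivAt (F := fun r : ℝ => π * (1 - r ^ 2)⁻¹) h0 ?_ ?_
    ?_).2]
  · field_simp
    ring
  · exact continuousOn_const.mul (ContinuousOn.inv₀ (by fun_prop) hne)
  · intro r hr
    have h1 : HasDerivAt (fun r : ℝ => 1 - r ^ 2) (-(2 * r)) r := by
      simpa using (hasDerivAt_pow 2 r).const_sub 1
    convert! (h1.inv (hne r (Set.Ioo_subset_Icc_self hr))).const_mul π using 1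
    ring
  · intro r hr
    have := hr.1
    positivity

variable {α : ℝ} {g : ℂ → ℂ}

lemma continuousOn_u {f : ℂ → ℂ} (hf : ContinuousOn f disk) : ContinuousOn (u α f) disk :=
  (hf.norm.pow 2).mul (continuousOn_weight (α + 2))

lemma continuousOn_pert (hg : ContinuousOn g disk) (ε : ℝ) : ContinuousOn (pert α g ε) disk := by
  unfold pert f₀
  fun_prop

lemma isOpen_superlevel {f : ℂ → ℂ} (hf : ContinuousOn f disk) (t : ℝ) :
    IsOpen (superlevel α f t) :=
  (continuousOn_u hf).isOpen_inter_preimage isOpen_disk isOpen_Ioi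

lemma superlevel_anti (f : ℂ → ℂ) {t t' : ℝ} (h : t ≤ t') :
    superlevel α f t' ⊆ superlevel α f t := fun _ hz => ⟨hz.1, h.trans_lt hz.2⟩

lemma superlevel_subset_disk (f : ℂ → ℂ) (t : ℝ) : superlevel α f t ⊆ disk := fun _ hz => hz.1

/-- Uniform confinement of the superlevel sets of the perturbations `f₀ + ε g`, `|ε| < ε₀`. -/
structure Confined (α s : ℝ) (g : ℂ → ℂ) (ε₀ R₁ t₁ : ℝ) : Prop where
  diff : DifferentiableOn ℂ g disk
  ε₀_pos : 0 < ε₀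
  R₁_nonneg : 0 ≤ R₁
  R₁_lt : R₁ < 1
  t₁_pos : 0 < t₁
  subset : ∀ ε, |ε| < ε₀ → superlevel α (pert α g ε) t₁ ⊆ Metric.closedBall 0 R₁
  large : ∀ ε, |ε| < ε₀ → ENNReal.ofReal s < hyp (superlevel α (pert α g ε) t₁)

/-- The growth bound keeps `ε² |g|² w` small up to the boundary of the disk, while `c² w` tends to
`0` there, so a fixed positive level is not exceeded near the boundary. If the level is low enough,
its superlevel set still contains a ball of radius greater than `R`, hence has area greater than
`s`. -/
lemma exists_confined (hα : -1 < α) (hg : g ∈ space α) {s R : ℝ} (hR0 : 0 < R) (hR1 : R < 1)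
    (hs : s = π * R ^ 2 / (1 - R ^ 2)) :
    ∃ ε₀ R₁ t₁, Confined α s g ε₀ R₁ t₁ ∧ R < R₁ ∧ t₁ < c₀ α ^ 2 * (1 - R ^ 2) ^ (α + 2) := by
  obtain ⟨C, hC0, hC⟩ := exists_growth_bound hg
  obtain ⟨R₂, hRR₂, hR₂⟩ := exists_between hR1
  obtain ⟨M, hM⟩ := (isCompact_closedBall (0 : ℂ) R₂).exists_bound_of_continuousOn
    (hg.1.continuousOn.mono (closedBall_subset_disk hR₂))
  have hM0 : 0 ≤ M := (norm_nonneg _).trans (hM 0 (by simp; linarith))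
  have hc := c₀_pos hα
  have hα2 : 0 < α + 2 := by linarith
  have hR₂w : 0 < 1 - R₂ ^ 2 := by nlinarith
  set w₂ := (1 - R₂ ^ 2) ^ (α + 2) with hw₂
  have hw₂0 : 0 < w₂ := rpow_pos_of_pos hR₂w _
  set t₁ := c₀ α ^ 2 / 8 * w₂ with ht₁
  have ht₁0 : 0 < t₁ := by positivity
  set y := (t₁ / (4 * c₀ α ^ 2)) ^ (α + 2)⁻¹ with hy
  have hy0 : 0 < y := by positivity
  -- The first bound gives `|ε g| ≤ c / 2` on the ball of radius `R₂`, so `u ≥ c² w₂ / 4 > t₁`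
  -- there. The second gives `2 ε² C < t₁ / 2`, so that `u > t₁` forces `w ≥ t₁ / (4 c²)`, that is
  -- `1 - |z|² ≥ y`.
  set ε₀ := min (c₀ α / (2 * (M + 1))) (√(t₁ / (4 * (C + 1)))) with hε₀
  have hε₀0 : 0 < ε₀ := lt_min (by positivity) (sqrt_pos.2 (by positivity))
  have hsub : ∀ ε, |ε| < ε₀ → Metric.ball (0 : ℂ) R₂ ⊆ superlevel α (pert α g ε) t₁ := by
    intro ε hε z hz
    rw [mem_ball_zero_iff] at hz
    refine ⟨by rw [disk, mem_ball_zero_iff]; linarith, ?_⟩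
    have h1 := hM z (by rw [mem_closedBall_zero_iff]; exact hz.le)
    have h2 : |ε| * (2 * (M + 1)) < c₀ α := by
      rw [← lt_div_iff₀ (by positivity)]
      exact hε.trans_le (min_le_left _ _)
    have h3 : c₀ α / 2 ≤ ‖pert α g ε z‖ := by
      have h4 := norm_sub_le_norm_add (f₀ α z) ((ε : ℂ) * g z)
      have h5 : ‖f₀ α z‖ = c₀ α := by
        rw [f₀, Complex.norm_real, Real.norm_of_nonneg (sqrt_nonneg _), c₀]
      rw [h5, norm_mul, Complex.norm_real, Real.norm_eq_abs] at h4
      have h6 : |ε| * ‖g z‖ ≤ |ε| * M := by gcongr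
      change _ ≤ ‖f₀ α z + ε * g z‖
      nlinarith [abs_nonneg ε]
    calc t₁ < (c₀ α / 2) ^ 2 * w₂ := by rw [ht₁]; nlinarith [mul_pos (pow_pos hc 2) hw₂0]
      _ ≤ ‖pert α g ε z‖ ^ 2 * (1 - ‖z‖ ^ 2) ^ (α + 2) := by
        have h7 : 1 - R₂ ^ 2 ≤ 1 - ‖z‖ ^ 2 := by gcongr
        have h8 : w₂ ≤ (1 - ‖z‖ ^ 2) ^ (α + 2) := rpow_le_rpow hR₂w.le h7 hα2.le
        gcongr
  refine ⟨ε₀, max R₂ (√(1 - y)), t₁, ⟨hg.1, hε₀0, ?_, ?_, ht₁0, ?_, ?_⟩, ?_, ?_⟩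
  · exact le_max_of_le_left (by linarith)
  · refine max_lt hR₂ ?_
    rw [Real.sqrt_lt' one_pos]
    linarith
  · intro ε hε z hz
    obtain ⟨hzd, hz⟩ := hz
    rw [mem_closedBall_zero_iff]
    refine le_max_of_le_right (Real.le_sqrt_of_sq_le ?_)
    have hpos := one_sub_sq_pos hzd
    have h1 : ε ^ 2 * (4 * (C + 1)) < t₁ := by
      rw [← lt_div_iff₀ (by positivity), ← sq_abs]
      have h2 : |ε| < √(t₁ / (4 * (C + 1))) := hε.trans_le (min_le_right _ _)
      exact (Real.lt_sqrt (abs_nonneg ε)).1 h2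
    have h2 : u α (pert α g ε) z ≤ 2 * c₀ α ^ 2 * (1 - ‖z‖ ^ 2) ^ (α + 2) + 2 * ε ^ 2 * C := by
      have h3 : ‖pert α g ε z‖ ^ 2 ≤ 2 * c₀ α ^ 2 + 2 * ε ^ 2 * ‖g z‖ ^ 2 := by
        rw [sq_norm_pert]
        have h4 : (g z).re ^ 2 ≤ ‖g z‖ ^ 2 := by
          rw [← sq_abs]; gcongr; exact Complex.abs_re_le_norm _
        nlinarith [sq_nonneg (c₀ α - ε * (g z).re), mul_le_mul_of_nonneg_left h4 (sq_nonneg ε)]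
      calc u α (pert α g ε) z ≤ (2 * c₀ α ^ 2 + 2 * ε ^ 2 * ‖g z‖ ^ 2) *
            (1 - ‖z‖ ^ 2) ^ (α + 2) := by unfold u; gcongr
        _ = 2 * c₀ α ^ 2 * (1 - ‖z‖ ^ 2) ^ (α + 2) +
            2 * ε ^ 2 * (‖g z‖ ^ 2 * (1 - ‖z‖ ^ 2) ^ (α + 2)) := by ring
        _ ≤ _ := by gcongr; exact hC z hzd
    have h3 : t₁ / (4 * c₀ α ^ 2) ≤ (1 - ‖z‖ ^ 2) ^ (α + 2) := by
      rw [div_le_iff₀ (by positivity)]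
      nlinarith [sq_nonneg ε]
    have h4 : y ≤ 1 - ‖z‖ ^ 2 := by
      rw [hy, Real.rpow_inv_le_iff_of_pos (by positivity) hpos.le hα2]
      exact h3
    linarith
  · intro ε hε
    refine lt_of_lt_of_le ?_ (measure_mono (hsub ε hε))
    rw [hyp_eq_ofReal hR₂ measurableSet_ball Metric.ball_subset_closedBall,
      integral_density_ball (by linarith) hR₂]
    have hR2 : R ^ 2 < R₂ ^ 2 := by gcongr
    have : s < π * R₂ ^ 2 / (1 - R₂ ^ 2) := by
      rw [hs]
      gcongr
    have hR₂0 : 0 < R₂ := hR0.trans hRR₂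
    exact (ENNReal.ofReal_lt_ofReal_iff (by positivity)).2 this
  · exact lt_max_of_lt_left hRR₂
  · have : w₂ ≤ (1 - R ^ 2) ^ (α + 2) := by
      rw [hw₂]
      gcongr
    rw [ht₁]
    nlinarith [mul_pos (pow_pos hc 2) hw₂0, mul_le_mul_of_nonneg_left this (sq_nonneg (c₀ α))]

lemma volume_eq_zero_of_rays {N : Set ℂ} (hN : MeasurableSet N)
    (h : ∀ θ, ∀ᵐ r ∂(volume.restrict (Set.Ioi (0 : ℝ))), circleMap 0 r θ ∉ N) :
    volume N = 0 := by
  have h1 := Complex.lintegral_comp_polarCoord_symm (N.indicator 1)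
  rw [lintegral_indicator_one hN] at h1
  simp only [polarCoord_symm_eq_circleMap] at h1
  rw [← h1, show polarCoord.target = Set.Ioi (0 : ℝ) ×ˢ Set.Ioo (-π) π from rfl,
    Measure.volume_eq_prod, ← Measure.prod_restrict, lintegral_prod_symm]
  · rw [lintegral_eq_zero_of_ae_eq_zero]
    refine ae_of_all _ fun θ => ?_
    simp only [Pi.zero_apply]
    refine lintegral_eq_zero_of_ae_eq_zero ?_
    filter_upwards [h θ] with r hr
    simp [hr]
  · refine Measurable.aemeasurable ?_
    have hm : Measurable (fun p : ℝ × ℝ => circleMap 0 p.1 p.2) := by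
      unfold circleMap
      fun_prop
    exact (measurable_fst.ennreal_ofReal).mul ((measurable_one.indicator hN).comp hm)

/-- Analyticity along rays serves to show that level sets are null. `|g|²` is expanded as `(Re g)² +
(Im g)²` because the norm is not analytic at zeros. -/
lemma analyticOnNhd_u_ray (hg : DifferentiableOn ℂ g disk) (ε θ : ℝ) :
    AnalyticOnNhd ℝ (fun r : ℝ => u α (pert α g ε) (circleMap 0 r θ)) (Set.Ioo 0 1) := by
  intro r hr
  have hpos : 0 < 1 - r ^ 2 := by nlinarith [hr.1, hr.2]
  have hmem : circleMap 0 r θ ∈ disk := by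
    rw [disk, mem_ball_zero_iff, norm_circleMap_zero, abs_of_pos hr.1]; exact hr.2
  have hga : AnalyticAt ℝ g (circleMap 0 r θ) :=
    (hg.analyticAt (isOpen_disk.mem_nhds hmem)).restrictScalars
  have hcm : AnalyticAt ℝ (fun r : ℝ => circleMap 0 r θ) r := by
    simp only [circleMap_zero]
    exact (Complex.ofRealCLM.analyticAt r).mul analyticAt_const
  have hgr : AnalyticAt ℝ (fun r : ℝ => g (circleMap 0 r θ)) r :=
    AnalyticAt.comp (f := fun r : ℝ => circleMap 0 r θ) hga hcm
  have hre : AnalyticAt ℝ (fun r : ℝ => (g (circleMap 0 r θ)).re) r :=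
    (Complex.reCLM.analyticAt _).comp hgr
  have him : AnalyticAt ℝ (fun r : ℝ => (g (circleMap 0 r θ)).im) r :=
    (Complex.imCLM.analyticAt _).comp hgr
  have hw : AnalyticAt ℝ (fun r : ℝ => (1 - r ^ 2) ^ (α + 2)) r := by
    refine ContDiffAt.analyticAt ?_
    exact ContDiffAt.rpow_const_of_ne (by fun_prop) hpos.ne'
  have hmain : AnalyticAt ℝ (fun r : ℝ => (c₀ α ^ 2 + 2 * c₀ α * ε * (g (circleMap 0 r θ)).re +
      ε ^ 2 * ((g (circleMap 0 r θ)).re * (g (circleMap 0 r θ)).re +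
      (g (circleMap 0 r θ)).im * (g (circleMap 0 r θ)).im)) * (1 - r ^ 2) ^ (α + 2)) r :=
    ((analyticAt_const.add (analyticAt_const.mul hre)).add
      (analyticAt_const.mul ((hre.mul hre).add (him.mul him)))).mul hw
  convert! hmain using 2 with r
  rw [u, sq_norm_pert, norm_circleMap_zero, sq_abs, ← Complex.normSq_eq_norm_sq,
    Complex.normSq_apply]

namespace Confined

variable {s ε₀ R₁ t₁ : ℝ}

lemma cont (h : Confined α s g ε₀ R₁ t₁) (ε : ℝ) : ContinuousOn (u α (pert α g ε)) disk :=
  continuousOn_u (continuousOn_pert h.diff.continuousOn ε)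

lemma measurableSet_superlevel (h : Confined α s g ε₀ R₁ t₁) (ε t : ℝ) :
    MeasurableSet (superlevel α (pert α g ε) t) :=
  (isOpen_superlevel (continuousOn_pert h.diff.continuousOn ε) t).measurableSet

lemma measurableSet_level (h : Confined α s g ε₀ R₁ t₁) (ε t : ℝ) :
    MeasurableSet {z | z ∈ disk ∧ u α (pert α g ε) z = t} := by
  have : {z | z ∈ disk ∧ u α (pert α g ε) z = t} =
      disk \ (superlevel α (pert α g ε) t ∪ (disk ∩ u α (pert α g ε) ⁻¹' Set.Iio t)) := by
    ext z
    simp only [superlevel, Set.mem_ofPred_eq, Set.mem_sdiff, Set.mem_union, Set.mem_inter_iff,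
      Set.mem_preimage, Set.mem_Iio, not_or, not_and, not_lt]
    constructor
    · rintro ⟨hz, rfl⟩
      exact ⟨hz, fun _ => le_rfl, fun _ => le_rfl⟩
    · rintro ⟨hz, h1, h2⟩
      exact ⟨hz, le_antisymm (h1 hz) (h2 hz)⟩
  rw [this]
  exact measurableSet_disk.diff ((h.measurableSet_superlevel ε t).union
    ((h.cont ε).isOpen_inter_preimage isOpen_disk isOpen_Iio).measurableSet)

/-- On each ray an analytic function takes the value `t` on a discrete set unless it is constantly
`t`. The latter would put points with `|z| > R₁` into the superlevel set at `t₁`, against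
confinement. -/
lemma volume_level_eq_zero (h : Confined α s g ε₀ R₁ t₁) {ε t : ℝ} (hε : |ε| < ε₀) (ht : t₁ < t) :
    volume {z | z ∈ disk ∧ u α (pert α g ε) z = t} = 0 := by
  refine volume_eq_zero_of_rays (h.measurableSet_level ε t) fun θ => ?_
  have hray : ∀ᵐ r ∂(volume.restrict (Set.Ioo (0 : ℝ) 1)),
      u α (pert α g ε) (circleMap 0 r θ) - t ≠ 0 := by
    rcases ((analyticOnNhd_u_ray (α := α) h.diff ε θ).sub
      analyticOnNhd_const).eqOn_zero_or_eventually_ne_zero_of_preconnected (f := fun r : ℝ =>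
        u α (pert α g ε) (circleMap 0 r θ) - t) isPreconnected_Ioo with h0 | h0
    · exfalso
      obtain ⟨r, hr1, hr2⟩ := exists_between h.R₁_lt
      have hr0 : 0 < r := h.R₁_nonneg.trans_lt hr1
      have h1 := h0 ⟨hr0, hr2⟩
      simp only [Pi.zero_apply, sub_eq_zero] at h1
      have h2 : circleMap 0 r θ ∈ superlevel α (pert α g ε) t₁ := by
        refine ⟨?_, by rw [h1]; exact ht⟩
        rw [disk, mem_ball_zero_iff, norm_circleMap_zero, abs_of_pos hr0]
        exact hr2
      have h3 := h.subset ε hε h2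
      rw [mem_closedBall_zero_iff, norm_circleMap_zero, abs_of_pos hr0] at h3
      linarith
    · exact ae_restrict_le_codiscreteWithin measurableSet_Ioo h0
  rw [ae_restrict_iff' measurableSet_Ioo] at hray
  rw [ae_restrict_iff' measurableSet_Ioi]
  filter_upwards [hray] with r hr hr0 hmem
  have hr0 : 0 < r := hr0
  have hlt := hmem.1
  rw [disk, mem_ball_zero_iff, norm_circleMap_zero, abs_of_pos hr0] at hlt
  exact hr ⟨hr0, hlt⟩ (sub_eq_zero.2 hmem.2)

lemma exists_superlevel_eq_empty (h : Confined α s g ε₀ R₁ t₁) {ε : ℝ} (hε : |ε| < ε₀) :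
    ∃ t, 0 ≤ t ∧ superlevel α (pert α g ε) t = ∅ := by
  obtain ⟨M, hM⟩ := (isCompact_closedBall (0 : ℂ) R₁).exists_bound_of_continuousOn
    ((h.cont ε).mono (closedBall_subset_disk h.R₁_lt))
  refine ⟨max M t₁, le_max_of_le_right h.t₁_pos.le, ?_⟩
  rw [Set.eq_empty_iff_forall_notMem]
  intro z hz
  have h1 := hM z (h.subset ε hε (superlevel_anti _ (le_max_right _ _) hz))
  have h2 := (le_max_left _ _).trans_lt hz.2
  exact absurd h2 (not_lt.2 ((le_abs_self _).trans h1))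

/-- Right continuity of the distribution function: the infimum defining `uStar` is attained. -/
lemma hyp_superlevel_uStar_le (h : Confined α s g ε₀ R₁ t₁) {ε : ℝ} (hε : |ε| < ε₀) :
    hyp (superlevel α (pert α g ε) (uStar α (pert α g ε) s)) ≤ ENNReal.ofReal s := by
  set T := {t : ℝ | 0 ≤ t ∧ hyp (superlevel α (pert α g ε) t) ≤ ENNReal.ofReal s}
  set t := uStar α (pert α g ε) s with ht
  have hne : T.Nonempty := by
    obtain ⟨t, h0, h1⟩ := h.exists_superlevel_eq_empty hε
    exact ⟨t, h0, by rw [h1]; simp⟩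
  obtain ⟨δ, hanti, hpos, hlim⟩ := exists_seq_strictAnti_tendsto (0 : ℝ)
  have hU : superlevel α (pert α g ε) t = ⋃ n, superlevel α (pert α g ε) (t + δ n) := by
    ext z
    simp only [Set.mem_iUnion]
    constructor
    · intro hz
      have : ∀ᶠ n in atTop, t + δ n < u α (pert α g ε) z := by
        have hl : Tendsto (fun n => t + δ n) atTop (𝓝 (t + 0)) := hlim.const_add t
        rw [add_zero] at hl
        exact hl.eventually (gt_mem_nhds hz.2)
      obtain ⟨n, hn⟩ := this.exists
      exact ⟨n, hz.1, hn⟩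
    · rintro ⟨n, hz⟩
      exact superlevel_anti _ (by linarith [hpos n]) hz
  have hmono : Monotone fun n => superlevel α (pert α g ε) (t + δ n) := fun m n hmn =>
    superlevel_anti _ (by linarith [hanti.antitone hmn])
  rw [hU]
  refine le_of_tendsto' (tendsto_measure_iUnion_atTop hmono) fun n => ?_
  have hlt : sInf T < t + δ n := lt_add_of_pos_right _ (hpos n)
  obtain ⟨t', ht', hlt'⟩ := exists_lt_of_csInf_lt hne hlt
  exact (measure_mono (superlevel_anti _ hlt'.le)).trans ht'.2

/-- The superlevel set at `t₁` has area greater than `s`, whereas the one at `uStar` has area at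
most `s`. Hence `Ω_ε` is confined too. -/
lemma lt_uStar (h : Confined α s g ε₀ R₁ t₁) {ε : ℝ} (hε : |ε| < ε₀) :
    t₁ < uStar α (pert α g ε) s := by
  by_contra hcon
  have := (measure_mono (superlevel_anti (pert α g ε) (not_lt.1 hcon))).trans
    (h.hyp_superlevel_uStar_le hε)
  exact absurd (h.large ε hε) (not_lt.2 this)

/-- Levels slightly below `uStar` have area greater than `s`. In the limit they exhaust the
superlevel set together with the level set, and the latter is null. -/
lemma hyp_superlevel_uStar (h : Confined α s g ε₀ R₁ t₁) {ε : ℝ} (hε : |ε| < ε₀) :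
    hyp (superlevel α (pert α g ε) (uStar α (pert α g ε) s)) = ENNReal.ofReal s := by
  refine le_antisymm (h.hyp_superlevel_uStar_le hε) ?_
  have htt := h.lt_uStar hε
  set T := {t : ℝ | 0 ≤ t ∧ hyp (superlevel α (pert α g ε) t) ≤ ENNReal.ofReal s} with hT
  set t := uStar α (pert α g ε) s with ht
  have hbdd : BddBelow T := ⟨0, fun t ht => ht.1⟩
  obtain ⟨δ, hanti, hpos, hlim⟩ := exists_seq_strictAnti_tendsto' (sub_pos.2 htt)
  have hl : Tendsto (fun n => t - δ n) atTop (𝓝 t) := by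
    have := hlim.const_sub t
    rwa [sub_zero] at this
  set S := fun n => superlevel α (pert α g ε) (t - δ n) with hS
  have hanti' : Antitone S := fun m n hmn =>
    superlevel_anti _ (by linarith [hanti.antitone hmn])
  have hsubS : ∀ n, S n ⊆ Metric.closedBall 0 R₁ := fun n =>
    (superlevel_anti _ (by linarith [(hpos n).2])).trans (h.subset ε hε)
  have h1 := tendsto_measure_iInter_atTop (μ := hyp)
    (fun n => (h.measurableSet_superlevel ε (t - δ n)).nullMeasurableSet) hanti'
    ⟨0, (hyp_lt_top h.R₁_lt (hsubS 0)).ne⟩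
  have h2 : ENNReal.ofReal s ≤ hyp (⋂ n, S n) := by
    refine ge_of_tendsto' h1 fun n => ?_
    by_contra hcon
    have hmem : t - δ n ∈ T := ⟨by linarith [(hpos n).2, h.t₁_pos], (not_le.1 hcon).le⟩
    have := csInf_le hbdd hmem
    have h3 : t = sInf T := rfl
    linarith [(hpos n).1]
  have h3 : ⋂ n, S n ⊆ superlevel α (pert α g ε) t ∪ {z | z ∈ disk ∧ u α (pert α g ε) z = t} := by
    intro z hz
    rw [Set.mem_iInter] at hz
    have h4 : t ≤ u α (pert α g ε) z := le_of_tendsto' hl fun n => (hz n).2.le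
    rcases h4.lt_or_eq with h5 | h5
    · exact Or.inl ⟨(hz 0).1, h5⟩
    · exact Or.inr ⟨(hz 0).1, h5.symm⟩
  calc ENNReal.ofReal s ≤ hyp (⋂ n, S n) := h2
    _ ≤ _ := measure_mono h3
    _ ≤ _ := measure_union_le _ _
    _ = _ := by
      rw [hyp_absolutelyContinuous (h.volume_level_eq_zero hε htt), add_zero]

end Confined

end Bergman

/-! ### The first derivative: bathtub principle, subgradients and continuity of the optimal set. -/

namespace Bergman

/-- A continuous selection of subgradients is the derivative. -/
lemma hasDerivAt_of_subgradient {F D : ℝ → ℝ} {x : ℝ} (hD : ContinuousAt D x)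
    (h : ∀ᶠ y in 𝓝 x, D x * (y - x) ≤ F y - F x ∧ D y * (x - y) ≤ F x - F y) :
    HasDerivAt F (D x) x := by
  rw [hasDerivAt_iff_isLittleO, Asymptotics.isLittleO_iff]
  intro c hc
  filter_upwards [h, Metric.tendsto_nhds.1 hD c hc] with y hy hcy
  rw [Real.dist_eq] at hcy
  rw [smul_eq_mul, Real.norm_eq_abs, Real.norm_eq_abs]
  have h1 : |F y - F x - (y - x) * D x| ≤ |D y - D x| * |y - x| := by
    rw [← abs_mul, abs_of_nonneg (by linarith [hy.1])]
    refine le_trans ?_ (le_abs_self _)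
    linarith [hy.2]
  exact h1.trans (by gcongr)

/-- Bathtub principle. -/
lemma setIntegral_le_setIntegral_superlevel {X : Type*} [MeasurableSpace X] {μ : Measure X}
    {A B : Set X} {v : X → ℝ} {t : ℝ} (hA : MeasurableSet A) (hB : MeasurableSet B)
    (hAt : ∀ x ∈ A, t ≤ v x) (hBt : ∀ x ∈ B, x ∉ A → v x ≤ t) (hAB : μ A = μ B)
    (hfin : μ A ≠ ⊤) (hvA : IntegrableOn v A μ) (hvB : IntegrableOn v B μ) :
    ∫ x in B, v x ∂μ ≤ ∫ x in A, v x ∂μ := by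
  have hcA : IntegrableOn (fun _ => t) A μ := integrableOn_const hfin
  have hcB : IntegrableOn (fun _ => t) B μ := integrableOn_const (hAB ▸ hfin)
  -- `v - t` is nonnegative on `A` and nonpositive on `B` outside `A`. The subtracted constants
  -- agree since `A` and `B` have equal measure.
  have h1 : ∫ x in B, (v x - t) ∂μ ≤ ∫ x in A, (v x - t) ∂μ := by
    rw [← integral_indicator hA, ← integral_indicator hB]
    refine integral_mono ((integrable_indicator_iff hB).2 (hvB.sub hcB))
      ((integrable_indicator_iff hA).2 (hvA.sub hcA)) fun x => ?_
    by_cases hxB : x ∈ B <;> by_cases hxA : x ∈ A <;> simp only [hxA, hxB, Set.indicator_of_mem,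
      Set.indicator_of_notMem, not_false_eq_true, le_refl, sub_nonneg, tsub_le_iff_right, zero_add]
    · exact hBt x hxB hxA
    · exact hAt x hxA
  rw [integral_sub hvA hcA, integral_sub hvB hcB, setIntegral_const, setIntegral_const,
    measureReal_def, measureReal_def, hAB] at h1
  linarith

lemma abs_setIntegral_sub_le {X : Type*} [MeasurableSpace X] {μ : Measure X}
    {A B : Set X} {ψ : X → ℝ} {M : ℝ} (hA : MeasurableSet A) (hAB : A ⊆ B) (hB : μ B ≠ ⊤)
    (hψ : IntegrableOn ψ B μ) (hM : ∀ x ∈ B, |ψ x| ≤ M) :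
    |(∫ x in B, ψ x ∂μ) - ∫ x in A, ψ x ∂μ| ≤ M * |μ.real B - μ.real A| := by
  rw [← setIntegral_sdiff hA hψ hAB, ← measureReal_sdiff hAB hA hB, abs_of_nonneg measureReal_nonneg]
  exact norm_setIntegral_le_of_norm_le_const (f := ψ) (measure_lt_top_mono Set.sdiff_subset hB.lt_top)
    fun x hx => hM x hx.1

variable {α : ℝ} {g : ℂ → ℂ}

/-- The superlevel set of `f₀ + ε g` of hyperbolic measure `s`. -/
def optimalSet (α s : ℝ) (g : ℂ → ℂ) (ε : ℝ) : Set ℂ :=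
  superlevel α (pert α g ε) (uStar α (pert α g ε) s)

lemma u_pert (α : ℝ) (g : ℂ → ℂ) (ε : ℝ) (z : ℂ) :
    u α (pert α g ε) z = c₀ α ^ 2 * weight (α + 2) z +
      2 * c₀ α * ε * ((g z).re * weight (α + 2) z) + ε ^ 2 * (‖g z‖ ^ 2 * weight (α + 2) z) := by
  rw [u, sq_norm_pert, weight]
  ring

lemma continuous_u_pert (α : ℝ) (g : ℂ → ℂ) (z : ℂ) :
    Continuous fun ε => u α (pert α g ε) z := by
  simp only [u_pert]
  fun_prop

namespace Confined

variable {s ε₀ R₁ t₁ : ℝ}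

lemma superlevel_subset (h : Confined α s g ε₀ R₁ t₁) {ε t : ℝ} (hε : |ε| < ε₀) (ht : t₁ ≤ t) :
    superlevel α (pert α g ε) t ⊆ Metric.closedBall 0 R₁ :=
  (superlevel_anti _ ht).trans (h.subset ε hε)

lemma optimalSet_subset (h : Confined α s g ε₀ R₁ t₁) {ε : ℝ} (hε : |ε| < ε₀) :
    optimalSet α s g ε ⊆ Metric.closedBall 0 R₁ :=
  h.superlevel_subset hε (h.lt_uStar hε).le

lemma measurableSet_optimalSet (h : Confined α s g ε₀ R₁ t₁) (ε : ℝ) :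
    MeasurableSet (optimalSet α s g ε) := h.measurableSet_superlevel _ _

lemma exists_bound (h : Confined α s g ε₀ R₁ t₁) {ψ : ℂ → ℝ} (hψ : ContinuousOn ψ disk) :
    ∃ M, ∀ z ∈ Metric.closedBall (0 : ℂ) R₁, |ψ z| ≤ M :=
  (isCompact_closedBall (0 : ℂ) R₁).exists_bound_of_continuousOn
    (hψ.mono (closedBall_subset_disk h.R₁_lt))

lemma integrableOn_hyp (h : Confined α s g ε₀ R₁ t₁) {ψ : ℂ → ℝ} (hψ : ContinuousOn ψ disk) :
    IntegrableOn ψ (Metric.closedBall 0 R₁) hyp := by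
  obtain ⟨M, hM⟩ := h.exists_bound hψ
  refine Integrable.mono' (g := fun _ => M)
    (integrableOn_const (hyp_lt_top h.R₁_lt le_rfl).ne) ?_ ?_
  · exact (hψ.mono (closedBall_subset_disk h.R₁_lt)).aestronglyMeasurable
      Metric.isClosed_closedBall.measurableSet
  · exact (ae_restrict_iff' Metric.isClosed_closedBall.measurableSet).2 (ae_of_all _ hM)

lemma measureReal_optimalSet (h : Confined α s g ε₀ R₁ t₁) (hs : 0 ≤ s) {ε : ℝ} (hε : |ε| < ε₀) :
    hyp.real (optimalSet α s g ε) = s := by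
  rw [measureReal_def, optimalSet, h.hyp_superlevel_uStar hε, ENNReal.toReal_ofReal hs]

/-- Superlevel sets of one function are nested, so that integrals over them are compared by
their measures. -/
lemma abs_integral_optimalSet_sub_le (h : Confined α s g ε₀ R₁ t₁) (hs : 0 ≤ s) {ψ : ℂ → ℝ}
    (hψ : ContinuousOn ψ disk) {M : ℝ} (hM : ∀ z ∈ Metric.closedBall (0 : ℂ) R₁, |ψ z| ≤ M)
    {ε t : ℝ} (hε : |ε| < ε₀) (ht : t₁ ≤ t) :
    |(∫ z in optimalSet α s g ε, ψ z ∂hyp) - ∫ z in superlevel α (pert α g ε) t, ψ z ∂hyp| ≤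
      M * |s - hyp.real (superlevel α (pert α g ε) t)| := by
  have hA := h.optimalSet_subset hε
  have hS := h.superlevel_subset hε ht
  have key : ∀ {A B : Set ℂ}, MeasurableSet A → A ⊆ B → B ⊆ Metric.closedBall 0 R₁ →
      |(∫ x in B, ψ x ∂hyp) - ∫ x in A, ψ x ∂hyp| ≤ M * |hyp.real B - hyp.real A| :=
    fun hmA hAB hB => abs_setIntegral_sub_le hmA hAB (hyp_lt_top h.R₁_lt hB).ne
      ((h.integrableOn_hyp hψ).mono_set hB) fun x hx => hM x (hB hx)
  have hsA := h.measureReal_optimalSet hs hε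
  rcases le_total t (uStar α (pert α g ε) s) with h1 | h1
  · have := key (h.measurableSet_optimalSet ε) (superlevel_anti _ h1) hS
    rwa [hsA, abs_sub_comm, abs_sub_comm (hyp.real _)] at this
  · have := key (A := superlevel α (pert α g ε) t) (B := optimalSet α s g ε)
      (h.measurableSet_superlevel ε t) (superlevel_anti _ h1) hA
    rwa [hsA] at this

lemma eventually_lt {ε : ℝ} (hε : |ε| < ε₀) :
    ∀ᶠ ε' in 𝓝 ε, |ε'| < ε₀ := continuous_abs.continuousAt.eventually (gt_mem_nhds hε)

/-- Off the null set `{u_ε = t}`, membership in the superlevel set is locally constant in the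
parameter, so dominated convergence applies. -/
lemma tendsto_integral_superlevel (h : Confined α s g ε₀ R₁ t₁) {ψ : ℂ → ℝ}
    (hψ : ContinuousOn ψ disk) {ε t : ℝ} (hε : |ε| < ε₀) (ht : t₁ < t) :
    Tendsto (fun ε' => ∫ z in superlevel α (pert α g ε') t, ψ z ∂hyp) (𝓝 ε)
      (𝓝 (∫ z in superlevel α (pert α g ε) t, ψ z ∂hyp)) := by
  obtain ⟨M, hM⟩ := h.exists_bound hψ
  have e : ∀ ε', |ε'| < ε₀ → ∫ z in superlevel α (pert α g ε') t, ψ z ∂hyp =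
      ∫ z in Metric.closedBall 0 R₁, (superlevel α (pert α g ε') t).indicator ψ z ∂hyp := by
    intro ε' hε'
    rw [setIntegral_indicator (h.measurableSet_superlevel ε' t),
      Set.inter_eq_right.2 (h.superlevel_subset hε' ht.le)]
  rw [e ε hε]
  refine Tendsto.congr' (f₁ := fun ε' => ∫ z in Metric.closedBall 0 R₁,
    (superlevel α (pert α g ε') t).indicator ψ z ∂hyp) ?_ ?_
  · filter_upwards [eventually_lt hε] with ε' hε' using (e ε' hε').symm
  refine tendsto_integral_filter_of_dominated_convergence (fun _ => M) ?_ ?_ ?_ ?_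
  · refine Eventually.of_forall fun ε' => ?_
    exact (h.integrableOn_hyp hψ).aestronglyMeasurable.indicator (h.measurableSet_superlevel ε' t)
  · refine Eventually.of_forall fun ε' => ?_
    refine (ae_restrict_iff' Metric.isClosed_closedBall.measurableSet).2 (ae_of_all _ fun z hz => ?_)
    exact (norm_indicator_le_norm_self _ _).trans (hM z hz)
  · exact integrableOn_const (hyp_lt_top h.R₁_lt le_rfl).ne
  · have hnull : ∀ᵐ z ∂hyp, z ∉ {z | z ∈ disk ∧ u α (pert α g ε) z = t} :=
      measure_eq_zero_iff_ae_notMem.1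
        (hyp_absolutelyContinuous (h.volume_level_eq_zero hε ht))
    refine (ae_restrict_iff' Metric.isClosed_closedBall.measurableSet).2 ?_
    filter_upwards [hnull] with z hz hzb
    have hzd := closedBall_subset_disk h.R₁_lt hzb
    have hne : u α (pert α g ε) z ≠ t := fun h => hz ⟨hzd, h⟩
    have hc := (continuous_u_pert α g z).continuousAt (x := ε)
    refine tendsto_const_nhds.congr' ?_
    rcases hne.lt_or_gt with h1 | h1
    · filter_upwards [hc.eventually (gt_mem_nhds h1)] with ε' h2
      rw [Set.indicator_of_notMem (fun h => lt_asymm h1 h.2),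
        Set.indicator_of_notMem (fun h => lt_asymm h2 h.2)]
    · filter_upwards [hc.eventually (lt_mem_nhds h1)] with ε' h2
      rw [Set.indicator_of_mem (show z ∈ superlevel α (pert α g ε) t from ⟨hzd, h1⟩),
        Set.indicator_of_mem (show z ∈ superlevel α (pert α g ε') t from ⟨hzd, h2⟩)]

lemma setIntegral_one (E : Set ℂ) : ∫ _ in E, (1 : ℝ) ∂hyp = hyp.real E := by simp

/-- The level is frozen at `t = u_ε^*(s)`. The area of the set at that level tends to `s`, and
nestedness turns the area defect into an integral defect, so the dependence of `uStar` on the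
parameter never enters. -/
lemma continuousAt_integral_optimalSet (h : Confined α s g ε₀ R₁ t₁) (hs : 0 ≤ s) {ψ : ℂ → ℝ}
    (hψ : ContinuousOn ψ disk) {ε : ℝ} (hε : |ε| < ε₀) :
    ContinuousAt (fun ε' => ∫ z in optimalSet α s g ε', ψ z ∂hyp) ε := by
  obtain ⟨M, hM⟩ := h.exists_bound hψ
  set t := uStar α (pert α g ε) s with ht
  have htt : t₁ < t := h.lt_uStar hε
  have h1 := h.tendsto_integral_superlevel hψ hε htt
  have h2 := h.tendsto_integral_superlevel (ψ := fun _ => 1) continuousOn_const hε htt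
  simp only [setIntegral_one] at h2
  rw [← optimalSet.eq_1, h.measureReal_optimalSet hs hε] at h2
  have h3 : Tendsto (fun ε' => M * |s - hyp.real (superlevel α (pert α g ε') t)|) (𝓝 ε) (𝓝 0) := by
    simpa using ((h2.const_sub s).abs.const_mul M)
  have h4 : Tendsto (fun ε' => (∫ z in optimalSet α s g ε', ψ z ∂hyp) -
      ∫ z in superlevel α (pert α g ε') t, ψ z ∂hyp) (𝓝 ε) (𝓝 0) := by
    refine squeeze_zero_norm' ?_ h3
    filter_upwards [eventually_lt hε] with ε' hε'
    exact h.abs_integral_optimalSet_sub_le hs hψ hM hε' htt.le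
  have h5 := h4.add h1
  simp only [sub_add_cancel, zero_add] at h5
  exact h5

/-- The derivative of `ε ↦ ∫ u dμ` over the optimal set. -/
def slopeAt (α s : ℝ) (g : ℂ → ℂ) (ε : ℝ) : ℝ :=
  2 * c₀ α * (∫ z in optimalSet α s g ε, (g z).re * weight (α + 2) z ∂hyp) +
    2 * ε * ∫ z in optimalSet α s g ε, ‖g z‖ ^ 2 * weight (α + 2) z ∂hyp

lemma continuousOn_re_mul (h : Confined α s g ε₀ R₁ t₁) (β : ℝ) :
    ContinuousOn (fun z => (g z).re * weight β z) disk :=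
  (Complex.continuous_re.comp_continuousOn h.diff.continuousOn).mul (continuousOn_weight _)

lemma continuousOn_sq_mul (h : Confined α s g ε₀ R₁ t₁) (β : ℝ) :
    ContinuousOn (fun z => ‖g z‖ ^ 2 * weight β z) disk :=
  (h.diff.continuousOn.norm.pow 2).mul (continuousOn_weight _)

lemma integral_u_pert (h : Confined α s g ε₀ R₁ t₁) {E : Set ℂ}
    (hE : E ⊆ Metric.closedBall 0 R₁) (ε : ℝ) :
    ∫ z in E, u α (pert α g ε) z ∂hyp = c₀ α ^ 2 * (∫ z in E, weight (α + 2) z ∂hyp) +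
      2 * c₀ α * ε * (∫ z in E, (g z).re * weight (α + 2) z ∂hyp) +
      ε ^ 2 * ∫ z in E, ‖g z‖ ^ 2 * weight (α + 2) z ∂hyp := by
  have i1 := ((h.integrableOn_hyp (continuousOn_weight (α + 2))).mono_set hE).const_mul (c₀ α ^ 2)
  have i2 := ((h.integrableOn_hyp (h.continuousOn_re_mul (α + 2))).mono_set hE).const_mul
    (2 * c₀ α * ε)
  have i3 := ((h.integrableOn_hyp (h.continuousOn_sq_mul (α + 2))).mono_set hE).const_mul (ε ^ 2)
  simp only [u_pert]
  have i12 : Integrable (fun z => c₀ α ^ 2 * weight (α + 2) z +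
      2 * c₀ α * ε * ((g z).re * weight (α + 2) z)) (hyp.restrict E) := i1.add i2
  rw [integral_add i12 i3, integral_add i1 i2, integral_const_mul, integral_const_mul,
    integral_const_mul]

/-- Testing the bathtub principle for `u_ε'` with `Ω_ε` bounds `I(ε')` below by a quadratic
polynomial in `ε'`, whose leading coefficient `∫ |g|² w dμ` is nonnegative. -/
lemma subgradient (h : Confined α s g ε₀ R₁ t₁) {ε ε' : ℝ} (hε : |ε| < ε₀)
    (hε' : |ε'| < ε₀) :
    slopeAt α s g ε * (ε' - ε) ≤ I α (pert α g ε') s - I α (pert α g ε) s := by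
  have hb : ∫ z in optimalSet α s g ε, u α (pert α g ε') z ∂hyp ≤ I α (pert α g ε') s := by
    refine setIntegral_le_setIntegral_superlevel (t := uStar α (pert α g ε') s)
      (h.measurableSet_optimalSet ε') (h.measurableSet_optimalSet ε)
      (fun z hz => hz.2.le) (fun z hz hz' => ?_) ?_ (hyp_lt_top h.R₁_lt (h.optimalSet_subset hε')).ne
      ((h.integrableOn_hyp (h.cont ε')).mono_set (h.optimalSet_subset hε'))
      ((h.integrableOn_hyp (h.cont ε')).mono_set (h.optimalSet_subset hε))
    · by_contra hcon
      exact hz' ⟨hz.1, not_le.1 hcon⟩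
    · change hyp (superlevel _ _ _) = hyp (superlevel _ _ _)
      rw [h.hyp_superlevel_uStar hε, h.hyp_superlevel_uStar hε']
  have e : I α (pert α g ε) s = ∫ z in optimalSet α s g ε, u α (pert α g ε) z ∂hyp := rfl
  have hsub := h.optimalSet_subset hε
  rw [h.integral_u_pert hsub] at hb e
  have hnn : 0 ≤ ∫ z in optimalSet α s g ε, ‖g z‖ ^ 2 * weight (α + 2) z ∂hyp :=
    setIntegral_nonneg (h.measurableSet_optimalSet ε) fun z hz => by
      have := weight_pos (α + 2) hz.1
      positivity
  rw [slopeAt]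
  nlinarith [mul_nonneg (sq_nonneg (ε' - ε)) hnn]

lemma hasDerivAt_I (h : Confined α s g ε₀ R₁ t₁) (hs : 0 ≤ s) {ε : ℝ} (hε : |ε| < ε₀) :
    HasDerivAt (fun ε => I α (pert α g ε) s) (slopeAt α s g ε) ε := by
  refine hasDerivAt_of_subgradient (D := slopeAt α s g) ?_ ?_
  · have h1 := h.continuousAt_integral_optimalSet hs (h.continuousOn_re_mul (α + 2)) hε
    have h2 := h.continuousAt_integral_optimalSet hs (h.continuousOn_sq_mul (α + 2)) hε
    exact (h1.const_mul _).add ((continuousAt_id.const_mul 2).mul h2)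
  · filter_upwards [eventually_lt hε] with ε' hε'
    exact ⟨h.subgradient hε hε', h.subgradient hε' hε⟩

end Confined

end Bergman

/-! ### First order motion of the superlevel set at a fixed level. -/

namespace Bergman

/-- Used where the factor `X` is only known to be continuous at `0`. -/
lemma hasDerivAt_mul_self_zero {X : ℝ → ℝ} (hX : ContinuousAt X 0) :
    HasDerivAt (fun ε => ε * X ε) (X 0) 0 := by
  rw [hasDerivAt_iff_tendsto_slope_zero]
  refine (hX.tendsto.mono_left nhdsWithin_le_nhds).congr' ?_
  filter_upwards [self_mem_nhdsWithin] with ε hε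
  have hε : ε ≠ 0 := hε
  simp [hε]

lemma eventually_gt_of_hasDerivAt_pos {f : ℝ → ℝ} {d : ℝ} (hf : HasDerivAt f d 0) (hd : 0 < d) :
    ∀ᶠ ε in 𝓝[>] (0 : ℝ), f 0 < f ε := by
  have h1 := hasDerivAt_iff_tendsto_slope_zero.1 hf
  have h2 : 𝓝[>] (0 : ℝ) ≤ 𝓝[≠] 0 := nhdsWithin_mono _ fun x hx => ne_of_gt hx
  filter_upwards [(h1.mono_left h2).eventually (lt_mem_nhds hd), self_mem_nhdsWithin] with ε h3 h4
  have h4 : 0 < ε := h4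
  rw [zero_add, smul_eq_mul] at h3
  have := pos_of_mul_pos_right h3 (inv_pos.2 h4).le
  linarith

lemma eventually_lt_of_hasDerivAt_neg {f : ℝ → ℝ} {d : ℝ} (hf : HasDerivAt f d 0) (hd : d < 0) :
    ∀ᶠ ε in 𝓝[>] (0 : ℝ), f ε < f 0 := by
  filter_upwards [eventually_gt_of_hasDerivAt_pos hf.neg (neg_pos.2 hd)] with ε hε
  exact neg_lt_neg_iff.1 hε

lemma rpow_mul_sub_le {a b β : ℝ} (hb : 0 < b) (hab : b ≤ a) (hβ : 0 ≤ β) :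
    b ^ β * (a - b) ≤ a ^ (β + 1) - b ^ (β + 1) := by
  have ha : 0 < a := hb.trans_le hab
  rw [rpow_add_one ha.ne', rpow_add_one hb.ne', mul_sub]
  gcongr

/-- The difference of the indicator functions of two half-lines. -/
def stepDiff (a y : ℝ) : ℝ := (Set.Iio a).indicator 1 y - (Set.Iio (0 : ℝ)).indicator 1 y

lemma integral_stepDiff (a : ℝ) : ∫ y, stepDiff a y = a := by
  rcases le_total 0 a with h | h
  · have e : stepDiff a = (Set.Ico 0 a).indicator 1 := by
      ext y
      simp only [stepDiff, Set.indicator_apply, Set.mem_Iio, Set.mem_Ico, Pi.one_apply]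
      split_ifs <;> grind
    rw [e, integral_indicator_one measurableSet_Ico]
    simp [h]
  · have e : stepDiff a = fun y => -(Set.Ico a 0).indicator 1 y := by
      ext y
      simp only [stepDiff, Set.indicator_apply, Set.mem_Iio, Set.mem_Ico, Pi.one_apply]
      split_ifs <;> grind
    rw [e, integral_neg, integral_indicator_one measurableSet_Ico]
    simp [h]

variable {α : ℝ} {g : ℂ → ℂ}

lemma circleMap_mem_disk {r : ℝ} (h0 : 0 ≤ r) (h1 : r < 1) (θ : ℝ) : circleMap 0 r θ ∈ disk := by
  rw [disk, mem_ball_zero_iff, norm_circleMap_zero, abs_of_nonneg h0]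
  exact h1

lemma measurable_indicator_of_continuousOn {φ : ℂ → ℝ} {E : Set ℂ} (hφ : ContinuousOn φ E)
    (hE : MeasurableSet E) : Measurable (E.indicator φ) := by
  classical
  have := hφ.measurable_piecewise (g := 0) continuousOn_const hE
  rwa [Set.piecewise_eq_indicator] at this

lemma continuousAt_comp_ray {φ : ℂ → ℝ} (hφ : ContinuousOn φ disk) {R : ℝ} (h0 : 0 ≤ R)
    (h1 : R < 1) (y θ : ℝ) : ContinuousAt (fun ε : ℝ => φ (circleMap 0 (R + ε * y) θ)) 0 := by
  have hm : circleMap 0 (R + 0 * y) θ ∈ disk := by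
    rw [zero_mul, add_zero]; exact circleMap_mem_disk h0 h1 θ
  have h2 : ContinuousAt φ (circleMap 0 (R + 0 * y) θ) :=
    hφ.continuousAt (isOpen_disk.mem_nhds hm)
  have h3 : ContinuousAt (fun ε : ℝ => circleMap 0 (R + ε * y) θ) 0 := by
    simp only [circleMap_zero]
    fun_prop
  exact ContinuousAt.comp (f := fun ε : ℝ => circleMap 0 (R + ε * y) θ) h2 h3

/-- Along `r = R + ε y` every term involving `g` carries a factor `ε`, so continuity of `g`
suffices. The derivative changes sign exactly at `y = displacement α R g θ`. -/
lemma hasDerivAt_u_ray (hg : ContinuousOn g disk) {R : ℝ} (h0 : 0 < R) (h1 : R < 1) (y θ : ℝ) :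
    HasDerivAt (fun ε => u α (pert α g ε) (circleMap 0 (R + ε * y) θ))
      (2 * c₀ α * (1 - R ^ 2) ^ (α + 1) *
        ((g (circleMap 0 R θ)).re * (1 - R ^ 2) - c₀ α * (α + 2) * R * y)) 0 := by
  have hpos : 0 < 1 - R ^ 2 := by nlinarith
  have hw := hasDerivAt_one_sub_sq_rpow (α + 2) (r := R) ⟨h0, h1⟩
  have hlin : HasDerivAt (fun ε : ℝ => R + ε * y) y 0 := by
    simpa using ((hasDerivAt_id (0 : ℝ)).mul_const y).const_add R
  have hw' : HasDerivAt (fun ε : ℝ => (1 - (R + ε * y) ^ 2) ^ (α + 2))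
      (-(2 * R) * (α + 2) * (1 - R ^ 2) ^ (α + 2 - 1) * y) 0 := by
    refine HasDerivAt.comp (h₂ := fun r : ℝ => (1 - r ^ 2) ^ (α + 2)) 0 ?_ hlin
    simpa using hw
  have hX : ContinuousAt (fun ε : ℝ => 2 * c₀ α * ((g (circleMap 0 (R + ε * y) θ)).re *
      weight (α + 2) (circleMap 0 (R + ε * y) θ)) +
      ε * (‖g (circleMap 0 (R + ε * y) θ)‖ ^ 2 *
      weight (α + 2) (circleMap 0 (R + ε * y) θ))) 0 := by
    have e1 := continuousAt_comp_ray ((Complex.continuous_re.comp_continuousOn hg).mul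
      (continuousOn_weight (α + 2))) h0.le h1 y θ
    have e2 := continuousAt_comp_ray ((hg.norm.pow 2).mul (continuousOn_weight (α + 2)))
      h0.le h1 y θ
    exact (e1.const_mul _).add (continuousAt_id.mul e2)
  have hsum := (hw'.const_mul (c₀ α ^ 2)).add (hasDerivAt_mul_self_zero hX)
  convert! hsum using 1
  · ext ε
    rw [u_pert]
    simp only [weight, norm_circleMap_zero, sq_abs, Pi.add_apply]
    ring
  · simp only [zero_mul, add_zero, weight, norm_circleMap_zero, sq_abs]
    have e : (1 - R ^ 2) ^ (α + 2) = (1 - R ^ 2) ^ (α + 1) * (1 - R ^ 2) := by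
      rw [← rpow_add_one hpos.ne']
      congr 1
      ring
    rw [show α + 2 - 1 = α + 1 by ring, e]
    ring

namespace Confined

variable {s ε₀ R₁ t₁ R : ℝ}

/-- `u_ε` differs from the radial `u_0` by `O(ε)` on the confining ball, and `u_0` decreases at
least linearly across `|z| = R`. The symmetric difference with the ball therefore lies in an annulus
of width `O(ε)`. This supplies the domination after rescaling. -/
lemma exists_thin (h : Confined α s g ε₀ R₁ t₁) (hα : -1 < α) (hR0 : 0 < R) (hRR₁ : R < R₁)
    (ht : t₁ < c₀ α ^ 2 * (1 - R ^ 2) ^ (α + 2)) :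
    ∃ C, 0 ≤ C ∧ ∀ ε, 0 < ε → ε < min 1 ε₀ → ∀ z,
      ¬ (z ∈ superlevel α (pert α g ε) (c₀ α ^ 2 * (1 - R ^ 2) ^ (α + 2)) ↔
        z ∈ Metric.ball (0 : ℂ) R) → |‖z‖ - R| ≤ C * ε ∧ ‖z‖ ≤ R₁ := by
  obtain ⟨M, hM⟩ := (isCompact_closedBall (0 : ℂ) R₁).exists_bound_of_continuousOn
    (h.diff.continuousOn.mono (closedBall_subset_disk h.R₁_lt))
  have hM0 : 0 ≤ M := (norm_nonneg _).trans (hM 0 (by simpa using h.R₁_nonneg))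
  have hc := c₀_pos hα
  have hR₁w : 0 < 1 - R₁ ^ 2 := by nlinarith [h.R₁_lt, h.R₁_nonneg]
  set k := (1 - R₁ ^ 2) ^ (α + 1) with hk
  have hk0 : 0 < k := rpow_pos_of_pos hR₁w _
  set K := 2 * c₀ α * M + M ^ 2 with hK
  have hK0 : 0 ≤ K := by positivity
  have hclose : ∀ ε, 0 < ε → ε < 1 → ∀ z ∈ Metric.closedBall (0 : ℂ) R₁,
      |u α (pert α g ε) z - c₀ α ^ 2 * (1 - ‖z‖ ^ 2) ^ (α + 2)| ≤ K * ε := by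
    intro ε h0 h1 z hz
    have hzd := closedBall_subset_disk h.R₁_lt hz
    have hw0 := weight_pos (α + 2) hzd
    have hw1 : weight (α + 2) z ≤ 1 := rpow_le_one (one_sub_sq_pos hzd).le
      (by nlinarith [norm_nonneg z]) (by linarith)
    have hre : |(g z).re| ≤ M := (Complex.abs_re_le_norm _).trans (hM z hz)
    have hn : ‖g z‖ ^ 2 ≤ M ^ 2 := by gcongr; exact hM z hz
    rw [u_pert]
    change |c₀ α ^ 2 * weight (α + 2) z + _ + _ - c₀ α ^ 2 * weight (α + 2) z| ≤ _
    have e : c₀ α ^ 2 * weight (α + 2) z + 2 * c₀ α * ε * ((g z).re * weight (α + 2) z) +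
        ε ^ 2 * (‖g z‖ ^ 2 * weight (α + 2) z) - c₀ α ^ 2 * weight (α + 2) z =
        ε * weight (α + 2) z * (2 * c₀ α * (g z).re + ε * ‖g z‖ ^ 2) := by ring
    rw [e, abs_mul, abs_of_pos (mul_pos h0 hw0)]
    have h2 : |2 * c₀ α * (g z).re + ε * ‖g z‖ ^ 2| ≤ K := by
      refine (abs_add_le _ _).trans ?_
      rw [abs_mul (2 * c₀ α), abs_mul ε, abs_of_pos (by positivity : 0 < 2 * c₀ α), abs_of_pos h0,
        abs_of_nonneg (sq_nonneg ‖g z‖), hK]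
      gcongr
      calc ε * ‖g z‖ ^ 2 ≤ 1 * M ^ 2 := by gcongr
        _ = M ^ 2 := one_mul _
    calc ε * weight (α + 2) z * |2 * c₀ α * (g z).re + ε * ‖g z‖ ^ 2| ≤ ε * 1 * K := by gcongr
      _ = K * ε := by ring
  have hgap : ∀ a b : ℝ, 0 ≤ a → a ≤ b → b ≤ R₁ → R ≤ b →
      c₀ α ^ 2 * k * R * (b - a) ≤
      c₀ α ^ 2 * (1 - a ^ 2) ^ (α + 2) - c₀ α ^ 2 * (1 - b ^ 2) ^ (α + 2) := by
    intro a b ha hab hb hRb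
    have hb0 : 0 < 1 - b ^ 2 := by nlinarith [h.R₁_lt]
    have h1 := rpow_mul_sub_le (a := 1 - a ^ 2) hb0 (by nlinarith) (by linarith : 0 ≤ α + 1)
    rw [show α + 1 + 1 = α + 2 by ring] at h1
    have h2 : k ≤ (1 - b ^ 2) ^ (α + 1) := by
      apply rpow_le_rpow hR₁w.le _ (by linarith)
      nlinarith
    have h3 : R * (b - a) ≤ 1 - a ^ 2 - (1 - b ^ 2) := by nlinarith
    have h4 : k * (R * (b - a)) ≤ (1 - b ^ 2) ^ (α + 1) * (1 - a ^ 2 - (1 - b ^ 2)) := by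
      have : 0 ≤ b - a := by linarith
      gcongr
    nlinarith [mul_le_mul_of_nonneg_left (h4.trans h1) (sq_nonneg (c₀ α))]
  have hC : 0 < c₀ α ^ 2 * k * R := by positivity
  refine ⟨K / (c₀ α ^ 2 * k * R), by positivity, fun ε h0 h1 z hz => ?_⟩
  have hε1 : ε < 1 := h1.trans_le (min_le_left _ _)
  have hεε : |ε| < ε₀ := by rw [abs_of_pos h0]; exact h1.trans_le (min_le_right _ _)
  rw [div_mul_eq_mul_div, le_div_iff₀ hC]
  by_cases hb : z ∈ Metric.ball (0 : ℂ) R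
  · have hS : z ∉ superlevel α (pert α g ε) (c₀ α ^ 2 * (1 - R ^ 2) ^ (α + 2)) := fun hS =>
      hz (iff_of_true hS hb)
    rw [mem_ball_zero_iff] at hb
    have hz1 : ‖z‖ ≤ R₁ := by linarith
    refine ⟨?_, hz1⟩
    have hzd : z ∈ disk := closedBall_subset_disk h.R₁_lt (by simpa using hz1)
    have h2 := hclose ε h0 hε1 z (by simpa using hz1)
    have h3 : u α (pert α g ε) z ≤ c₀ α ^ 2 * (1 - R ^ 2) ^ (α + 2) := by
      by_contra hcon
      exact hS ⟨hzd, not_le.1 hcon⟩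
    have h4 := hgap ‖z‖ R (norm_nonneg z) hb.le hRR₁.le le_rfl
    rw [abs_sub_comm, abs_of_pos (sub_pos.2 hb)]
    have := (abs_le.1 h2).1
    linarith
  · have hS : z ∈ superlevel α (pert α g ε) (c₀ α ^ 2 * (1 - R ^ 2) ^ (α + 2)) := by
      by_contra hS
      exact hz (iff_of_false hS hb)
    have hzb := h.superlevel_subset hεε ht.le hS
    rw [mem_ball_zero_iff, not_lt] at hb
    have hz1 : ‖z‖ ≤ R₁ := by simpa using hzb
    refine ⟨?_, hz1⟩
    have h2 := hclose ε h0 hε1 z hzb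
    have h3 := hS.2
    have h4 := hgap R ‖z‖ hR0.le hb hz1 hb
    rw [abs_of_nonneg (sub_nonneg.2 hb)]
    have := (abs_le.1 h2).2
    linarith

end Confined

end Bergman

namespace Bergman

variable {α : ℝ} {g : ℂ → ℂ}

/-- The level of `u` for `f₀` on the circle of radius `R`. -/
def baseLevel (α R : ℝ) : ℝ := c₀ α ^ 2 * (1 - R ^ 2) ^ (α + 2)

/-- The signed density of the superlevel set of `f₀ + ε g` relative to the ball of radius `R`. -/
def deviation (α R : ℝ) (g : ℂ → ℂ) (φ : ℂ → ℝ) (ε : ℝ) (z : ℂ) : ℝ :=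
  (superlevel α (pert α g ε) (baseLevel α R)).indicator φ z - (Metric.ball 0 R).indicator φ z

/-- The deviation along a ray, in the variable `y` with `r = R + ε y`. -/
def rayDeviation (α R : ℝ) (g : ℂ → ℂ) (φ : ℂ → ℝ) (ε θ y : ℝ) : ℝ :=
  (Set.Ioi 0).indicator (fun r => r * deviation α R g φ ε (circleMap 0 r θ)) (R + ε * y)

/-- First order radial displacement of the superlevel set. -/
def displacement (α R : ℝ) (g : ℂ → ℂ) (θ : ℝ) : ℝ :=
  (g (circleMap 0 R θ)).re * (1 - R ^ 2) / (c₀ α * (α + 2) * R)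

/-- Substitution `r = R + ε y`, whose Jacobian absorbs `ε⁻¹`. -/
lemma setIntegral_Ioi_eq_integral_rayDeviation (φ : ℂ → ℝ) {R ε : ℝ} (hε : 0 < ε) (θ : ℝ) :
    ε⁻¹ * ∫ r in Set.Ioi (0 : ℝ), r * deviation α R g φ ε (circleMap 0 r θ) =
      ∫ y, rayDeviation α R g φ ε θ y := by
  rw [← integral_indicator measurableSet_Ioi]
  set f := (Set.Ioi (0 : ℝ)).indicator fun r => r * deviation α R g φ ε (circleMap 0 r θ) with hf
  have h1 : ∫ y, rayDeviation α R g φ ε θ y = ∫ y, (fun x => f (R + x)) (ε * y) := rfl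
  rw [h1, Measure.integral_comp_mul_left (fun x => f (R + x)) ε, integral_add_left_eq_self, abs_of_pos (inv_pos.2 hε),
    smul_eq_mul]

/-- For small `ε > 0` the point at `R + ε y` lies in the superlevel set iff `y` is below the
displacement, and in the ball iff `y < 0`. -/
lemma tendsto_rayDeviation (hα : -1 < α) (hg : ContinuousOn g disk) {φ : ℂ → ℝ}
    (hφ : ContinuousOn φ disk) {R : ℝ} (h0 : 0 < R) (h1 : R < 1) (θ : ℝ) {y : ℝ}
    (hy : y ≠ displacement α R g θ) :
    Tendsto (fun ε => rayDeviation α R g φ ε θ y) (𝓝[>] 0)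
      (𝓝 (R * φ (circleMap 0 R θ) * stepDiff (displacement α R g θ) y)) := by
  have hc := c₀_pos hα
  have hpos : 0 < 1 - R ^ 2 := by nlinarith
  have hα2 : 0 < α + 2 := by linarith
  have hd := hasDerivAt_u_ray (α := α) hg h0 h1 y θ
  have hbase : u α (pert α g 0) (circleMap 0 (R + 0 * y) θ) = baseLevel α R := by
    rw [u_pert]
    simp [weight, norm_circleMap_zero, sq_abs, baseLevel]
  have hden : 0 < c₀ α * (α + 2) * R := by positivity
  have hr : Tendsto (fun ε : ℝ => R + ε * y) (𝓝[>] 0) (𝓝 R) := by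
    have : ContinuousAt (fun ε : ℝ => R + ε * y) 0 := by fun_prop
    have := this.tendsto
    simp only [zero_mul, add_zero] at this
    exact this.mono_left nhdsWithin_le_nhds
  have hr0 : ∀ᶠ ε in 𝓝[>] (0 : ℝ), 0 < R + ε * y := hr.eventually (lt_mem_nhds h0)
  have hr1 : ∀ᶠ ε in 𝓝[>] (0 : ℝ), R + ε * y < 1 := hr.eventually (gt_mem_nhds h1)
  have hS : ∀ᶠ ε in 𝓝[>] (0 : ℝ), (superlevel α (pert α g ε) (baseLevel α R)).indicator φ
      (circleMap 0 (R + ε * y) θ) = φ (circleMap 0 (R + ε * y) θ) *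
        (Set.Iio (displacement α R g θ)).indicator 1 y := by
    rcases hy.lt_or_gt with hlt | hgt
    · have hpos' : 0 < (g (circleMap 0 R θ)).re * (1 - R ^ 2) - c₀ α * (α + 2) * R * y := by
        rw [displacement, lt_div_iff₀ hden] at hlt
        linarith
      filter_upwards [eventually_gt_of_hasDerivAt_pos hd (mul_pos (by positivity) hpos'), hr0, hr1]
        with ε h2 h3 h4
      rw [hbase] at h2
      rw [Set.indicator_of_mem (show _ ∈ superlevel α (pert α g ε) (baseLevel α R) from
        ⟨circleMap_mem_disk h3.le h4 θ, h2⟩), Set.indicator_of_mem (Set.mem_Iio.2 hlt)]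
      simp
    · have hneg : (g (circleMap 0 R θ)).re * (1 - R ^ 2) - c₀ α * (α + 2) * R * y < 0 := by
        rw [displacement, div_lt_iff₀ hden] at hgt
        linarith
      filter_upwards [eventually_lt_of_hasDerivAt_neg hd
        (mul_neg_of_pos_of_neg (by positivity) hneg)] with ε h2
      rw [hbase] at h2
      rw [Set.indicator_of_notMem (fun hm => lt_asymm h2 hm.2),
        Set.indicator_of_notMem (fun hm => lt_asymm hgt (Set.mem_Iio.1 hm)), mul_zero]
  have hB : ∀ᶠ ε in 𝓝[>] (0 : ℝ), (Metric.ball (0 : ℂ) R).indicator φ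
      (circleMap 0 (R + ε * y) θ) = φ (circleMap 0 (R + ε * y) θ) *
        (Set.Iio (0 : ℝ)).indicator 1 y := by
    filter_upwards [hr0, self_mem_nhdsWithin] with ε h3 h4
    have h4 : 0 < ε := h4
    have hmem : circleMap 0 (R + ε * y) θ ∈ Metric.ball (0 : ℂ) R ↔ y < 0 := by
      rw [mem_ball_zero_iff, norm_circleMap_zero, abs_of_pos h3]
      constructor
      · intro h; by_contra hcon; nlinarith [mul_nonneg h4.le (not_lt.1 hcon)]
      · intro h; nlinarith [mul_neg_of_pos_of_neg h4 h]
    by_cases hy' : y < 0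
    · rw [Set.indicator_of_mem (hmem.2 hy'), Set.indicator_of_mem (Set.mem_Iio.2 hy')]
      simp
    · rw [Set.indicator_of_notMem (fun h => hy' (hmem.1 h)),
        Set.indicator_of_notMem (fun h => hy' (Set.mem_Iio.1 h)), mul_zero]
  have hlim : Tendsto (fun ε : ℝ => (R + ε * y) * φ (circleMap 0 (R + ε * y) θ) *
      stepDiff (displacement α R g θ) y) (𝓝[>] 0)
      (𝓝 (R * φ (circleMap 0 R θ) * stepDiff (displacement α R g θ) y)) := by
    have h2 := (continuousAt_comp_ray hφ h0.le h1 y θ).tendsto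
    simp only [zero_mul, add_zero] at h2
    exact (hr.mul (h2.mono_left nhdsWithin_le_nhds)).mul_const _
  refine hlim.congr' ?_
  filter_upwards [hr0, hS, hB] with ε h2 h3 h4
  rw [rayDeviation, Set.indicator_of_mem (Set.mem_Ioi.2 h2), deviation, h3, h4, stepDiff]
  ring

namespace Confined

variable {s ε₀ R₁ t₁ R : ℝ}

/-- First variation of the integral over the superlevel set at fixed level, from the right. -/
lemma tendsto_integral_superlevel_sub (h : Confined α s g ε₀ R₁ t₁) (hα : -1 < α) (hR0 : 0 < R)
    (hRR₁ : R < R₁) (ht : t₁ < baseLevel α R) {φ : ℂ → ℝ} (hφ : ContinuousOn φ disk) :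
    Tendsto (fun ε => ε⁻¹ * ((∫ z in superlevel α (pert α g ε) (baseLevel α R), φ z) -
      ∫ z in Metric.ball 0 R, φ z)) (𝓝[>] 0)
      (𝓝 (∫ θ in Set.Ioo (-π) π, R * φ (circleMap 0 R θ) * displacement α R g θ)) := by
  have hR1 : R < 1 := hRR₁.trans h.R₁_lt
  obtain ⟨C, hC0, hC⟩ := h.exists_thin hα hR0 hRR₁ ht
  obtain ⟨M, hM⟩ := h.exists_bound hφ
  have hM0 : 0 ≤ M := (abs_nonneg _).trans (hM 0 (by simpa using h.R₁_nonneg))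
  have hε₁ : 0 < min 1 ε₀ := lt_min one_pos h.ε₀_pos
  have hsmall : ∀ᶠ ε in 𝓝[>] (0 : ℝ), 0 < ε ∧ ε < min 1 ε₀ :=
    Ioo_mem_nhdsGT hε₁
  have hmeas : ∀ ε, Measurable (deviation α R g φ ε) := fun ε =>
    (measurable_indicator_of_continuousOn (hφ.mono (superlevel_subset_disk _ _))
      (h.measurableSet_superlevel ε _)).sub (measurable_indicator_of_continuousOn
      (hφ.mono (Metric.ball_subset_ball hR1.le)) measurableSet_ball)
  -- In the rescaled variable the thin annulus becomes `|y| ≤ C`, uniformly in `ε` and `θ`. The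
  -- Jacobian factor `r = |z|` is at most `1`.
  have hray : ∀ ε, 0 < ε → ε < min 1 ε₀ → ∀ θ y, ‖rayDeviation α R g φ ε θ y‖ ≤
      (Set.Icc (-C) C).indicator (fun _ => M) y := by
    intro ε h0 h1 θ y
    by_cases hr : 0 < R + ε * y
    · rw [rayDeviation, Set.indicator_of_mem (Set.mem_Ioi.2 hr)]
      set z := circleMap 0 (R + ε * y) θ with hz
      have hnz : ‖z‖ = R + ε * y := by rw [hz, norm_circleMap_zero, abs_of_pos hr]
      by_cases hiff : z ∈ superlevel α (pert α g ε) (baseLevel α R) ↔ z ∈ Metric.ball (0 : ℂ) R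
      · have : deviation α R g φ ε z = 0 := by
          rw [deviation]
          by_cases hm : z ∈ Metric.ball (0 : ℂ) R
          · rw [Set.indicator_of_mem hm, Set.indicator_of_mem (hiff.2 hm), sub_self]
          · rw [Set.indicator_of_notMem hm, Set.indicator_of_notMem (mt hiff.1 hm), sub_self]
        rw [this, mul_zero, norm_zero]
        exact Set.indicator_nonneg (fun _ _ => hM0) _
      · obtain ⟨h2, h3⟩ := hC ε h0 h1 z hiff
        rw [hnz, add_sub_cancel_left, abs_mul, abs_of_pos h0, mul_comm,
          mul_le_mul_iff_left₀ h0] at h2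
        rw [Set.indicator_of_mem (Set.mem_Icc.2 (abs_le.1 h2)), norm_mul, Real.norm_of_nonneg hr.le,
          ← hnz]
        have h4 : ‖deviation α R g φ ε z‖ ≤ M := by
          have hb := hM z (by simpa using h3)
          rw [deviation]
          by_cases hm : z ∈ Metric.ball (0 : ℂ) R
          · rw [Set.indicator_of_mem hm, Set.indicator_of_notMem
              (fun hS => hiff (iff_of_true hS hm)), zero_sub, norm_neg]
            exact hb
          · by_cases hS : z ∈ superlevel α (pert α g ε) (baseLevel α R)
            · rw [Set.indicator_of_notMem hm, Set.indicator_of_mem hS, sub_zero]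
              exact hb
            · exact absurd (iff_of_false hS hm) hiff
        calc ‖z‖ * ‖deviation α R g φ ε z‖ ≤ 1 * M := by
              gcongr
              exact h3.trans h.R₁_lt.le
          _ = M := one_mul M
    · rw [rayDeviation, Set.indicator_of_notMem (by simpa using hr), norm_zero]
      exact Set.indicator_nonneg (fun _ _ => hM0) _
  have hdom : Integrable ((Set.Icc (-C) C).indicator fun _ => M) :=
    (integrable_indicator_iff measurableSet_Icc).2 (integrableOn_const (by simp))
  have hinner : ∀ θ, Tendsto (fun ε => ∫ y, rayDeviation α R g φ ε θ y) (𝓝[>] 0)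
      (𝓝 (R * φ (circleMap 0 R θ) * displacement α R g θ)) := by
    intro θ
    have e : R * φ (circleMap 0 R θ) * displacement α R g θ =
        ∫ y, R * φ (circleMap 0 R θ) * stepDiff (displacement α R g θ) y := by
      rw [integral_const_mul, integral_stepDiff]
    rw [e]
    refine tendsto_integral_filter_of_dominated_convergence _ ?_ ?_ hdom ?_
    · refine Eventually.of_forall fun ε => Measurable.aestronglyMeasurable ?_
      have hcm : Measurable fun r : ℝ => circleMap 0 r θ := by
        unfold circleMap
        fun_prop
      have h1 : Measurable ((Set.Ioi (0 : ℝ)).indicator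
          fun r => r * deviation α R g φ ε (circleMap 0 r θ)) :=
        (measurable_id.mul ((hmeas ε).comp hcm)).indicator measurableSet_Ioi
      exact h1.comp (by fun_prop : Measurable fun y : ℝ => R + ε * y)
    · filter_upwards [hsmall] with ε hε
      exact ae_of_all _ fun y => hray ε hε.1 hε.2 θ y
    · filter_upwards [Measure.ae_ne volume (displacement α R g θ)] with y hy
      exact tendsto_rayDeviation hα h.diff.continuousOn hφ hR0 hR1 θ hy
  have hintg : ∀ ε, |ε| < ε₀ → Integrable (deviation α R g φ ε) := by
    intro ε hε
    have hi : IntegrableOn φ (Metric.closedBall 0 R₁) :=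
      (hφ.mono (closedBall_subset_disk h.R₁_lt)).integrableOn_compact (isCompact_closedBall _ _)
    refine Integrable.sub ?_ ?_
    · exact (integrable_indicator_iff (h.measurableSet_superlevel ε _)).2
        (hi.mono_set (h.superlevel_subset hε ht.le))
    · exact (integrable_indicator_iff measurableSet_ball).2
        (hi.mono_set (Metric.ball_subset_closedBall.trans (Metric.closedBall_subset_closedBall
          hRR₁.le)))
  have hpolar : ∀ ε, 0 < ε → ε < min 1 ε₀ →
      Integrable (fun θ => ∫ y, rayDeviation α R g φ ε θ y) (volume.restrict (Set.Ioo (-π) π)) ∧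
      ε⁻¹ * ((∫ z in superlevel α (pert α g ε) (baseLevel α R), φ z) -
        ∫ z in Metric.ball 0 R, φ z) =
      ∫ θ in Set.Ioo (-π) π, ∫ y, rayDeviation α R g φ ε θ y := by
    intro ε h0 h1
    have hεε : |ε| < ε₀ := by rw [abs_of_pos h0]; exact h1.trans_le (min_le_right _ _)
    have hp := integrableOn_polar (hintg ε hεε)
    have he := integral_eq_polar (deviation α R g φ ε)
    have hi : IntegrableOn φ (Metric.closedBall 0 R₁) :=
      (hφ.mono (closedBall_subset_disk h.R₁_lt)).integrableOn_compact (isCompact_closedBall _ _)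
    have hsplit : ∫ z, deviation α R g φ ε z =
        (∫ z in superlevel α (pert α g ε) (baseLevel α R), φ z) - ∫ z in Metric.ball 0 R, φ z := by
      unfold deviation
      rw [integral_sub, integral_indicator (h.measurableSet_superlevel ε _),
        integral_indicator measurableSet_ball]
      · exact (integrable_indicator_iff (h.measurableSet_superlevel ε _)).2
          (hi.mono_set (h.superlevel_subset hεε ht.le))
      · exact (integrable_indicator_iff measurableSet_ball).2
          (hi.mono_set (Metric.ball_subset_closedBall.trans (Metric.closedBall_subset_closedBall
            hRR₁.le)))
    rw [polarDomain, IntegrableOn, Measure.volume_eq_prod, ← Measure.prod_restrict] at hp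
    rw [polarDomain, Measure.volume_eq_prod, ← Measure.prod_restrict, integral_prod_symm _ hp] at he
    simp only [smul_eq_mul] at he
    have hq := hp.integral_prod_right.const_mul ε⁻¹
    simp only [smul_eq_mul, setIntegral_Ioi_eq_integral_rayDeviation φ h0] at hq
    refine ⟨hq, ?_⟩
    rw [← hsplit, he, ← integral_const_mul]
    simp only [setIntegral_Ioi_eq_integral_rayDeviation φ h0]
  have hcongr : (fun ε => ∫ θ in Set.Ioo (-π) π, ∫ y, rayDeviation α R g φ ε θ y) =ᶠ[𝓝[>] 0]
      fun ε => ε⁻¹ * ((∫ z in superlevel α (pert α g ε) (baseLevel α R), φ z) -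
        ∫ z in Metric.ball 0 R, φ z) := by
    filter_upwards [hsmall] with ε hε
    exact ((hpolar ε hε.1 hε.2).2).symm
  refine Tendsto.congr' hcongr ?_
  refine tendsto_integral_filter_of_dominated_convergence
    (fun _ => ∫ y, (Set.Icc (-C) C).indicator (fun _ => M) y) ?_ ?_ ?_ ?_
  · filter_upwards [hsmall] with ε hε
    exact (hpolar ε hε.1 hε.2).1.aestronglyMeasurable
  · filter_upwards [hsmall] with ε hε
    exact ae_of_all _ fun θ => norm_integral_le_of_norm_le hdom
      (ae_of_all _ fun y => hray ε hε.1 hε.2 θ y)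
  · exact integrableOn_const (by simp)
  · exact ae_of_all _ hinner

end Confined

end Bergman

/-! ### The second derivative at zero. -/

namespace Bergman

variable {α : ℝ} {g : ℂ → ℂ}

lemma pert_neg (α : ℝ) (g : ℂ → ℂ) (ε : ℝ) : pert α (-g) ε = pert α g (-ε) := by
  ext z
  simp [pert]

lemma displacement_neg (α R : ℝ) (g : ℂ → ℂ) (θ : ℝ) :
    displacement α R (-g) θ = -displacement α R g θ := by
  simp only [displacement, Pi.neg_apply, Complex.neg_re]
  ring

lemma superlevel_pert_zero (hα : -1 < α) (g : ℂ → ℂ) {R : ℝ} (h0 : 0 ≤ R) (h1 : R < 1) :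
    superlevel α (pert α g 0) (baseLevel α R) = Metric.ball 0 R := by
  have hc := c₀_pos hα
  have hR : 0 < 1 - R ^ 2 := by nlinarith
  ext z
  have e : u α (pert α g 0) z = c₀ α ^ 2 * (1 - ‖z‖ ^ 2) ^ (α + 2) := by
    rw [u_pert]; simp [weight]
  rw [superlevel, Set.mem_ofPred_eq, e, baseLevel, mem_ball_zero_iff,
    mul_lt_mul_iff_right₀ (by positivity)]
  constructor
  · rintro ⟨hz, hlt⟩
    rw [rpow_lt_rpow_iff hR.le (one_sub_sq_pos hz).le (by linarith)] at hlt
    exact lt_of_pow_lt_pow_left₀ 2 h0 (by linarith)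
  · intro hz
    have hzd : z ∈ disk := by rw [disk, mem_ball_zero_iff]; linarith
    refine ⟨hzd, rpow_lt_rpow hR.le ?_ (by linarith)⟩
    gcongr

namespace Confined

variable {s ε₀ R₁ t₁ R : ℝ}

lemma neg (h : Confined α s g ε₀ R₁ t₁) : Confined α s (-g) ε₀ R₁ t₁ where
  diff := h.diff.neg
  ε₀_pos := h.ε₀_pos
  R₁_nonneg := h.R₁_nonneg
  R₁_lt := h.R₁_lt
  t₁_pos := h.t₁_pos
  subset ε hε := by
    rw [pert_neg]
    exact h.subset _ (by rwa [abs_neg])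
  large ε hε := by
    rw [pert_neg]
    exact h.large _ (by rwa [abs_neg])

/-- First variation of the integral over the superlevel set at fixed level. -/
lemma hasDerivAt_integral_superlevel (h : Confined α s g ε₀ R₁ t₁) (hα : -1 < α) (hR0 : 0 < R)
    (hRR₁ : R < R₁) (ht : t₁ < baseLevel α R) {φ : ℂ → ℝ} (hφ : ContinuousOn φ disk) :
    HasDerivAt (fun ε => ∫ z in superlevel α (pert α g ε) (baseLevel α R), φ z)
      (∫ θ in Set.Ioo (-π) π, R * φ (circleMap 0 R θ) * displacement α R g θ) 0 := by
  rw [hasDerivAt_iff_tendsto_slope_zero]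
  simp only [zero_add, smul_eq_mul, superlevel_pert_zero hα g hR0.le (hRR₁.trans h.R₁_lt)]
  rw [← Set.Iio_union_Ioi, nhdsWithin_union, tendsto_sup]
  refine ⟨?_, h.tendsto_integral_superlevel_sub hα hR0 hRR₁ ht hφ⟩
  -- The left derivative for `g` is the right derivative for `-g`.
  have h1 := h.neg.tendsto_integral_superlevel_sub hα hR0 hRR₁ ht hφ
  have hneg : Tendsto (fun ε : ℝ => -ε) (𝓝[<] 0) (𝓝[>] 0) := by
    have := tendsto_neg_nhdsLT (a := (0 : ℝ))
    rwa [neg_zero] at this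
  have h2 := (h1.comp hneg).neg
  simp only [displacement_neg, mul_neg, integral_neg, neg_neg] at h2
  refine h2.congr fun ε => ?_
  simp only [Function.comp_apply, pert_neg, neg_neg, inv_neg]
  ring

lemma hasDerivAt_integral_hyp_superlevel (h : Confined α s g ε₀ R₁ t₁) (hα : -1 < α)
    (hR0 : 0 < R) (hRR₁ : R < R₁) (ht : t₁ < baseLevel α R) {ψ : ℂ → ℝ}
    (hψ : ContinuousOn ψ disk) :
    HasDerivAt (fun ε => ∫ z in superlevel α (pert α g ε) (baseLevel α R), ψ z ∂hyp)
      (R * ((1 - R ^ 2) ^ 2)⁻¹ * ∫ θ in Set.Ioo (-π) π, ψ (circleMap 0 R θ) * displacement α R g θ)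
      0 := by
  have h1 := h.hasDerivAt_integral_superlevel hα hR0 hRR₁ ht (continuousOn_density.mul hψ)
  have e : (fun ε => ∫ z in superlevel α (pert α g ε) (baseLevel α R), ψ z ∂hyp) =
      fun ε => ∫ z in superlevel α (pert α g ε) (baseLevel α R), density z * ψ z := by
    ext ε
    exact setIntegral_hyp (h.measurableSet_superlevel ε _) (superlevel_subset_disk _ _) ψ
  rw [e, ← integral_const_mul]
  convert! h1 using 1
  refine integral_congr_ae (ae_of_all _ fun θ => ?_)
  simp only [Pi.mul_apply, density, norm_circleMap_zero, sq_abs]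
  ring

lemma integral_optimalSet_zero (h : Confined α s g ε₀ R₁ t₁) (hα : -1 < α) (hs : 0 ≤ s)
    (hR0 : 0 < R) (hRR₁ : R < R₁) (ht : t₁ < baseLevel α R) (hsR : s = π * R ^ 2 / (1 - R ^ 2))
    {ψ : ℂ → ℝ} (hψ : ContinuousOn ψ disk) :
    ∫ z in optimalSet α s g 0, ψ z ∂hyp = ∫ z in Metric.ball 0 R, ψ z ∂hyp := by
  obtain ⟨M, hM⟩ := h.exists_bound hψ
  have hR1 : R < 1 := hRR₁.trans h.R₁_lt
  have h1 := h.abs_integral_optimalSet_sub_le hs hψ hM (ε := 0) (by simpa using h.ε₀_pos) ht.le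
  rw [superlevel_pert_zero hα g hR0.le hR1, measureReal_def,
    hyp_eq_ofReal hR1 measurableSet_ball Metric.ball_subset_closedBall,
    integral_density_ball hR0.le hR1, ← hsR, ENNReal.toReal_ofReal hs, sub_self, abs_zero,
    mul_zero] at h1
  exact sub_eq_zero.1 (abs_nonpos_iff.1 h1)

/-- With zero mean displacement the fixed-level set has area `s + o(ε)`. Integrals over it and over
`Ω_ε` then differ by `o(ε)`, so the moving level contributes nothing to first order. -/
lemma hasDerivAt_integral_optimalSet (h : Confined α s g ε₀ R₁ t₁) (hα : -1 < α) (hs : 0 ≤ s)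
    (hR0 : 0 < R) (hRR₁ : R < R₁) (ht : t₁ < baseLevel α R) (hsR : s = π * R ^ 2 / (1 - R ^ 2))
    (hdisp : ∫ θ in Set.Ioo (-π) π, displacement α R g θ = 0) {ψ : ℂ → ℝ}
    (hψ : ContinuousOn ψ disk) :
    HasDerivAt (fun ε => ∫ z in optimalSet α s g ε, ψ z ∂hyp)
      (R * ((1 - R ^ 2) ^ 2)⁻¹ * ∫ θ in Set.Ioo (-π) π, ψ (circleMap 0 R θ) * displacement α R g θ)
      0 := by
  obtain ⟨M, hM⟩ := h.exists_bound hψ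
  have hR1 : R < 1 := hRR₁.trans h.R₁_lt
  have h1 := h.hasDerivAt_integral_hyp_superlevel hα hR0 hRR₁ ht hψ
  have h2 := h.hasDerivAt_integral_hyp_superlevel hα hR0 hRR₁ ht (ψ := fun _ => 1)
    continuousOn_const
  simp only [one_mul, hdisp, mul_zero, setIntegral_one] at h2
  have hs0 : hyp.real (superlevel α (pert α g 0) (baseLevel α R)) = s := by
    rw [superlevel_pert_zero hα g hR0.le hR1, measureReal_def,
      hyp_eq_ofReal hR1 measurableSet_ball Metric.ball_subset_closedBall,
      integral_density_ball hR0.le hR1, ← hsR, ENNReal.toReal_ofReal hs]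
  have h0 : ∫ z in optimalSet α s g 0, ψ z ∂hyp =
      ∫ z in superlevel α (pert α g 0) (baseLevel α R), ψ z ∂hyp := by
    rw [h.integral_optimalSet_zero hα hs hR0 hRR₁ ht hsR hψ,
      superlevel_pert_zero hα g hR0.le hR1]
  have h3 : HasDerivAt (fun ε => (∫ z in optimalSet α s g ε, ψ z ∂hyp) -
      ∫ z in superlevel α (pert α g ε) (baseLevel α R), ψ z ∂hyp) 0 0 := by
    rw [hasDerivAt_iff_isLittleO] at h2 ⊢
    simp only [smul_zero, sub_zero, hs0, h0, sub_self] at h2 ⊢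
    refine Asymptotics.IsBigO.trans_isLittleO (Asymptotics.IsBigO.of_bound M ?_) h2
    filter_upwards [eventually_lt (ε := 0) (by simpa using h.ε₀_pos)] with ε hε
    rw [Real.norm_eq_abs, Real.norm_eq_abs, abs_sub_comm (hyp.real _)]
    exact h.abs_integral_optimalSet_sub_le hs hψ hM hε ht.le
  have h4 := h3.add h1
  rw [zero_add] at h4
  convert! h4 using 1
  ext ε
  simp

/-- The displacement is proportional to `Re g`, so the boundary term is a mean of `(Re g)²`. As
`g(0) = 0`, both `g` and `g²` have zero circle means: the first makes the mean displacement vanish,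
the second turns the mean of `(Re g)²` into half that of `|g|²`. -/
lemma hasDerivAt_slopeAt (h : Confined α s g ε₀ R₁ t₁) (hα : -1 < α) (hs : 0 ≤ s)
    (hR0 : 0 < R) (hRR₁ : R < R₁) (ht : t₁ < baseLevel α R) (hsR : s = π * R ^ 2 / (1 - R ^ 2))
    (hg0 : g 0 = 0) :
    HasDerivAt (slopeAt α s g)
      (2 * π * (1 - R ^ 2) ^ (α + 1) / (α + 2) * circleAverage (fun z => ‖g z‖ ^ 2) 0 R +
        2 * ∫ z in Metric.ball 0 R, ‖g z‖ ^ 2 * weight α z) 0 := by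
  have hR1 : R < 1 := hRR₁.trans h.R₁_lt
  have hpos : 0 < 1 - R ^ 2 := by nlinarith
  have hc := c₀_pos hα
  have hα2 : 0 < α + 2 := by linarith
  have hci : CircleIntegrable g 0 R :=
    circleIntegrable_of_continuousOn_ball h.diff.continuousOn hR0.le hR1
  have hre : circleAverage (fun z => (g z).re) 0 R = 0 := by
    have h1 := Complex.reCLM.circleAverage_comp_comm hci
    rw [circleAverage_eq_of_differentiableOn h.diff hR0.le hR1, hg0] at h1
    simpa [Function.comp_def] using h1
  have hre2 : circleAverage (fun z => (g z).re ^ 2) 0 R =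
      circleAverage (fun z => ‖g z‖ ^ 2) 0 R / 2 := by
    have hci2 : CircleIntegrable (fun z => g z ^ 2) 0 R :=
      circleIntegrable_of_continuousOn_ball (h.diff.continuousOn.pow 2) hR0.le hR1
    have hcin : CircleIntegrable (fun z => ‖g z‖ ^ 2) 0 R :=
      circleIntegrable_of_continuousOn_ball (h.diff.continuousOn.norm.pow 2) hR0.le hR1
    have hcir : CircleIntegrable (fun z => (g z ^ 2).re) 0 R :=
      circleIntegrable_of_continuousOn_ball
        (Complex.continuous_re.comp_continuousOn (h.diff.continuousOn.pow 2)) hR0.le hR1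
    have h1 := Complex.reCLM.circleAverage_comp_comm hci2
    rw [circleAverage_eq_of_differentiableOn (f := fun z => g z ^ 2) (h.diff.pow 2) hR0.le hR1,
      hg0] at h1
    have h2 : circleAverage (fun z => (g z ^ 2).re) 0 R = 0 := by
      simpa [Function.comp_def] using h1
    have e : (fun z => (g z).re ^ 2) =
        fun z => (2⁻¹ : ℝ) • ((fun z => ‖g z‖ ^ 2) z + (fun z => (g z ^ 2).re) z) := by
      ext z
      simp only [smul_eq_mul]
      rw [← Complex.normSq_eq_norm_sq, Complex.normSq_apply, pow_two (g z), Complex.mul_re]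
      ring
    rw [e, circleAverage_fun_smul, circleAverage_fun_add hcin hcir, h2, add_zero, smul_eq_mul]
    ring
  have hdisp : ∫ θ in Set.Ioo (-π) π, displacement α R g θ = 0 := by
    have e : ∀ θ, displacement α R g θ =
        (1 - R ^ 2) / (c₀ α * (α + 2) * R) * (fun z => (g z).re) (circleMap 0 R θ) := fun θ => by
      rw [displacement]; ring
    simp only [e]
    rw [integral_const_mul, integral_Ioo_eq_circleAverage (fun z => (g z).re), hre]
    simp
  have hP := h.hasDerivAt_integral_optimalSet hα hs hR0 hRR₁ ht hsR hdisp
    (h.continuousOn_re_mul (α + 2))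
  have hQ := hasDerivAt_mul_self_zero (h.continuousAt_integral_optimalSet hs
    (h.continuousOn_sq_mul (α + 2)) (ε := 0) (by simpa using h.ε₀_pos))
  have hsum := (hP.const_mul (2 * c₀ α)).add (hQ.const_mul 2)
  convert! hsum using 1
  · ext ε
    simp only [slopeAt, Pi.add_apply]
    ring
  · congr 1
    · have e : ∀ θ, (g (circleMap 0 R θ)).re * weight (α + 2) (circleMap 0 R θ) *
          displacement α R g θ = (1 - R ^ 2) ^ (α + 2) * (1 - R ^ 2) / (c₀ α * (α + 2) * R) *
            (fun z => (g z).re ^ 2) (circleMap 0 R θ) := fun θ => by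
        rw [displacement, weight, norm_circleMap_zero, sq_abs]
        ring
      simp only [e]
      rw [integral_const_mul, integral_Ioo_eq_circleAverage (fun z => (g z).re ^ 2), hre2,
        smul_eq_mul]
      have e2 : (1 - R ^ 2) ^ (α + 2) = (1 - R ^ 2) ^ (α + 1) * (1 - R ^ 2) := by
        rw [← rpow_add_one hpos.ne']
        congr 1
        ring
      rw [e2]
      field_simp
    · rw [h.integral_optimalSet_zero hα hs hR0 hRR₁ ht hsR (h.continuousOn_sq_mul (α + 2)),
        setIntegral_hyp measurableSet_ball (Metric.ball_subset_ball hR1.le)]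
      congr 1
      refine setIntegral_congr_fun measurableSet_ball fun z hz => ?_
      have hz1 := one_sub_sq_pos (Metric.ball_subset_ball hR1.le hz)
      simp only [density, weight]
      rw [rpow_add hz1, rpow_two]
      field_simp

lemma I_pert_zero (h : Confined α s g ε₀ R₁ t₁) (hα : -1 < α) (hs : 0 ≤ s)
    (hR0 : 0 < R) (hRR₁ : R < R₁) (ht : t₁ < baseLevel α R)
    (hsR : s = π * R ^ 2 / (1 - R ^ 2)) :
    I α (pert α g 0) s = 1 - (1 - R ^ 2) ^ (α + 1) := by
  have hR1 : R < 1 := hRR₁.trans h.R₁_lt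
  have e : I α (pert α g 0) s = ∫ z in optimalSet α s g 0, u α (pert α g 0) z ∂hyp := rfl
  rw [e, h.integral_optimalSet_zero hα hs hR0 hRR₁ ht hsR (h.cont 0),
    setIntegral_hyp measurableSet_ball (Metric.ball_subset_ball hR1.le)]
  have e2 : ∀ z ∈ Metric.ball (0 : ℂ) R, density z * u α (pert α g 0) z =
      c₀ α ^ 2 * weight α z := by
    intro z hz
    have hz1 := one_sub_sq_pos (Metric.ball_subset_ball hR1.le hz)
    rw [u_pert, density, weight, weight, rpow_add hz1, rpow_two]
    field_simp
    ring
  rw [setIntegral_congr_fun measurableSet_ball e2, integral_const_mul,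
    integral_weight_ball hα hR0.le hR1.le, c₀_sq hα]
  have hα1 : α + 1 ≠ 0 := by linarith
  field_simp

end Confined

end Bergman

/-! ### The radial extremal problem and the final bound. -/

namespace Bergman

/-- The ratio of truncated and full moments for `z²`, boundary term included. -/
def momentRatio (α R : ℝ) : ℝ :=
  1 - (1 - R ^ 2) ^ (α + 1) - (α + 1) / 2 * (1 - R ^ 2) ^ (α + 1) * (R ^ 2 * (2 - R ^ 2))

/-- The equality case `N = 1` of `radial_inequality`, corresponding to `g` proportional to `z²`. -/
lemma momentRatio_eq {α : ℝ} (hα : -1 < α) {R : ℝ} (h0 : 0 < R) (h1 : R < 1) :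
    (∫ r in Set.Ioo 0 R, r ^ 5 * (1 - r ^ 2) ^ α) +
      (1 - R ^ 2) ^ (α + 1) * R ^ 4 / (2 * (α + 2)) =
    momentRatio α R * ∫ r in Set.Ioo (0 : ℝ) 1, r ^ 5 * (1 - r ^ 2) ^ α := by
  have hpos : 0 < 1 - R ^ 2 := by nlinarith
  have hα1 : α + 1 ≠ 0 := by linarith
  have hα2 : α + 2 ≠ 0 := by linarith
  have hα3 : α + 3 ≠ 0 := by linarith
  rw [(radial_weight_integral_pow_five hα h0.le h1.le).2,
    (radial_weight_integral_pow_five hα zero_le_one le_rfl).2, one_pow, sub_self, zero_rpow hα1,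
    zero_rpow hα2, zero_rpow hα3, momentRatio]
  have e2 : (1 - R ^ 2) ^ (α + 2) = (1 - R ^ 2) ^ (α + 1) * (1 - R ^ 2) := by
    rw [← rpow_add_one hpos.ne']
    congr 1
    ring
  have e3 : (1 - R ^ 2) ^ (α + 3) = (1 - R ^ 2) ^ (α + 1) * (1 - R ^ 2) ^ 2 := by
    rw [← rpow_two (1 - R ^ 2), ← rpow_add hpos]
    congr 1
    ring
  rw [e2, e3]
  field_simp
  ring

lemma momentRatio_le_one {α : ℝ} (hα : -1 < α) {R : ℝ} (h0 : 0 < R) (h1 : R < 1) :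
    momentRatio α R ≤ 1 := by
  have hpos : 0 < 1 - R ^ 2 := by nlinarith
  have h2 : 0 < 2 - R ^ 2 := by linarith
  have h3 : 0 < α + 1 := by linarith
  have : 0 < (α + 1) / 2 * (1 - R ^ 2) ^ (α + 1) * (R ^ 2 * (2 - R ^ 2)) := by positivity
  have : 0 < (1 - R ^ 2) ^ (α + 1) := by positivity
  rw [momentRatio]
  linarith

lemma radial_pos {α r : ℝ} (hr : r ∈ Set.Ioo (0 : ℝ) 1) : 0 < r ^ 5 * (1 - r ^ 2) ^ α := by
  have h0 := hr.1
  have : 0 < 1 - r ^ 2 := by nlinarith [hr.1, hr.2]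
  positivity

lemma momentRatio_nonneg {α : ℝ} (hα : -1 < α) {R : ℝ} (h0 : 0 < R) (h1 : R < 1) :
    0 ≤ momentRatio α R := by
  have h := momentRatio_eq hα h0 h1
  have hpos : 0 < 1 - R ^ 2 := by nlinarith
  have hα2 : 0 < α + 2 := by linarith
  have hA : 0 ≤ ∫ r in Set.Ioo 0 R, r ^ 5 * (1 - r ^ 2) ^ α :=
    setIntegral_nonneg measurableSet_Ioo fun r hr => (radial_pos ⟨hr.1, hr.2.trans h1⟩).le
  have hB : 0 ≤ ∫ r in Set.Ioo (0 : ℝ) 1, r ^ 5 * (1 - r ^ 2) ^ α :=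
    setIntegral_nonneg measurableSet_Ioo fun r hr => (radial_pos hr).le
  have hC : 0 < (1 - R ^ 2) ^ (α + 1) * R ^ 4 / (2 * (α + 2)) := by positivity
  by_contra hcon
  nlinarith [mul_nonneg (neg_nonneg.2 (not_le.1 hcon).le) hB]

/-- The radial inequality behind the second variation: among nondecreasing profiles, constants are
extremal. -/
lemma radial_inequality {α : ℝ} (hα : -1 < α) {R : ℝ} (h0 : 0 < R) (h1 : R < 1) {N : ℝ → ℝ}
    (hN : MonotoneOn N (Set.Ioo 0 1))
    (hintg : IntegrableOn (fun r => r ^ 5 * (1 - r ^ 2) ^ α * N r) (Set.Ioo 0 1)) :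
    (∫ r in Set.Ioo 0 R, r ^ 5 * (1 - r ^ 2) ^ α * N r) +
      (1 - R ^ 2) ^ (α + 1) * R ^ 4 / (2 * (α + 2)) * N R ≤
    momentRatio α R * ∫ r in Set.Ioo (0 : ℝ) 1, r ^ 5 * (1 - r ^ 2) ^ α * N r := by
  set w := fun r : ℝ => r ^ 5 * (1 - r ^ 2) ^ α with hw
  have hw1 : IntegrableOn w (Set.Ioo 0 1) :=
    (radial_weight_integral_pow_five hα zero_le_one le_rfl).1
  have hsub : Set.Ioo 0 R ⊆ Set.Ioo 0 1 := Set.Ioo_subset_Ioo_right h1.le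
  have hR : R ∈ Set.Ioo (0 : ℝ) 1 := ⟨h0, h1⟩
  -- Subtracting the constant profile `N R` reduces the claim to `f = w (N - N R)`, which is
  -- nonpositive before `R` and nonnegative after. The constant part is restored through
  -- `momentRatio_eq`.
  set f := fun r : ℝ => w r * N r - N R * w r with hf
  have hf1 : IntegrableOn f (Set.Ioo 0 1) := hintg.sub (hw1.const_mul (N R))
  have heR : ∫ r in Set.Ioo 0 R, f r = (∫ r in Set.Ioo 0 R, w r * N r) -
      N R * ∫ r in Set.Ioo 0 R, w r := by
    rw [hf, integral_sub (hintg.mono_set hsub) ((hw1.mono_set hsub).const_mul (N R)),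
      integral_const_mul]
  have he1 : ∫ r in Set.Ioo (0 : ℝ) 1, f r = (∫ r in Set.Ioo (0 : ℝ) 1, w r * N r) -
      N R * ∫ r in Set.Ioo (0 : ℝ) 1, w r := by
    rw [hf, integral_sub hintg (hw1.const_mul (N R)), integral_const_mul]
  have hneg : ∫ r in Set.Ioo 0 R, f r ≤ 0 := by
    refine setIntegral_nonpos measurableSet_Ioo fun r hr => ?_
    have h2 := hN (hsub hr) hR hr.2.le
    have h3 := radial_pos (α := α) (hsub hr)
    change w r * N r - N R * w r ≤ 0
    nlinarith [mul_nonneg h3.le (sub_nonneg.2 h2)]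
  have hle : ∫ r in Set.Ioo 0 R, f r ≤ ∫ r in Set.Ioo (0 : ℝ) 1, f r := by
    have hdis := setIntegral_sdiff (measurableSet_Ioo (a := (0 : ℝ)) (b := R)) hf1 hsub
    have hge : 0 ≤ ∫ r in Set.Ioo (0 : ℝ) 1 \ Set.Ioo 0 R, f r := by
      refine setIntegral_nonneg (measurableSet_Ioo.diff measurableSet_Ioo) fun r hr => ?_
      have hRr : R ≤ r := by
        by_contra hcon
        exact hr.2 ⟨hr.1.1, not_le.1 hcon⟩
      have h2 := hN hR hr.1 hRr
      have h3 := radial_pos (α := α) hr.1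
      change 0 ≤ w r * N r - N R * w r
      nlinarith [mul_nonneg h3.le (sub_nonneg.2 h2)]
    linarith
  have hC0 := momentRatio_nonneg hα h0 h1
  have hC1 := momentRatio_le_one hα h0 h1
  have hmain : ∫ r in Set.Ioo 0 R, f r ≤ momentRatio α R * ∫ r in Set.Ioo (0 : ℝ) 1, f r := by
    -- Multiplying a nonpositive number by a factor at most `1` increases it. Extending to `(0, 1)`
    -- only adds nonnegative mass, and the factor is nonnegative.
    calc ∫ r in Set.Ioo 0 R, f r ≤ momentRatio α R * ∫ r in Set.Ioo 0 R, f r := by nlinarith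
      _ ≤ _ := by gcongr
  have heq := momentRatio_eq hα h0 h1
  rw [heR, he1] at hmain
  have heq' := congrArg (fun x => x * N R) heq
  simp only [add_mul] at heq'
  change (∫ r in Set.Ioo 0 R, w r * N r) + _ ≤ momentRatio α R * ∫ r in Set.Ioo (0 : ℝ) 1, w r * N r
  change (∫ r in Set.Ioo 0 R, w r) * N R + _ =
    momentRatio α R * (∫ r in Set.Ioo (0 : ℝ) 1, w r) * N R at heq'
  linarith

/-- The quadratic form of the second variation on functions vanishing to second order. -/
lemma quadratic_form_le {α : ℝ} (hα : -1 < α) {g h : ℂ → ℂ} (hg : g ∈ space α)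
    (hnorm : norm α g = 1) (hh : DifferentiableOn ℂ h disk) (hgh : ∀ z, g z = z ^ 2 * h z)
    {R : ℝ} (h0 : 0 < R) (h1 : R < 1) :
    π * (1 - R ^ 2) ^ (α + 1) / (α + 2) * circleAverage (fun z => ‖g z‖ ^ 2) 0 R +
      ∫ z in Metric.ball 0 R, ‖g z‖ ^ 2 * weight α z ≤ momentRatio α R := by
  set N := fun r : ℝ => circleAverage (fun z => ‖h z‖ ^ 2) 0 r with hN
  have hcirc : ∀ r, 0 ≤ r → circleAverage (fun z => ‖g z‖ ^ 2) 0 r = r ^ 4 * N r := by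
    intro r hr
    have := circleAverage_radial_smul (fun z => ‖h z‖ ^ 2) (fun r => r ^ 4) hr
    simp only [smul_eq_mul] at this
    rw [hN, ← this]
    congr 1
    ext z
    rw [hgh, norm_mul, norm_pow]
    ring
  have hpt : ∀ r, 0 ≤ r → (2 * π * r) • circleAverage (fun z => ‖g z‖ ^ 2 * weight α z) 0 r =
      2 * π * (r ^ 5 * (1 - r ^ 2) ^ α * N r) := by
    intro r hr
    rw [circleAverage_weight_mul _ _ hr, hcirc r hr, smul_eq_mul]
    ring
  have hi : IntegrableOn (fun z => ‖g z‖ ^ 2 * weight α z) (Metric.ball 0 1) := hg.2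
  have hpolar : ∀ ρ, ρ ≤ 1 → ∫ z in Metric.ball 0 ρ, ‖g z‖ ^ 2 * weight α z =
      2 * π * ∫ r in Set.Ioo 0 ρ, r ^ 5 * (1 - r ^ 2) ^ α * N r := by
    intro ρ hρ
    rw [setIntegral_ball_eq_circleAverage (hi.mono_set (Metric.ball_subset_ball hρ)),
      ← integral_const_mul]
    exact setIntegral_congr_fun measurableSet_Ioo fun r hr => hpt r hr.1.le
  have hintg : IntegrableOn (fun r => r ^ 5 * (1 - r ^ 2) ^ α * N r) (Set.Ioo 0 1) := by
    have := (integrableOn_Ioo_circleAverage hi).const_mul (2 * π)⁻¹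
    refine IntegrableOn.congr_fun this (fun r hr => ?_) measurableSet_Ioo
    rw [hpt r hr.1.le, ← mul_assoc, inv_mul_cancel₀ (by positivity), one_mul]
  have hmono : MonotoneOn N (Set.Ioo 0 1) := fun r hr r' hr' hrr' =>
    circleAverage_sq_norm_mono hh hr.1.le hrr' hr'.2
  have hone : 2 * π * ∫ r in Set.Ioo (0 : ℝ) 1, r ^ 5 * (1 - r ^ 2) ^ α * N r = 1 := by
    have e := sq_norm_eq (α := α) g
    rw [hnorm, one_pow] at e
    rw [← hpolar 1 le_rfl]
    exact e.symm
  have hineq := radial_inequality hα h0 h1 hmono hintg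
  rw [hpolar R h1.le, hcirc R h0.le]
  have hα2 : α + 2 ≠ 0 := by linarith
  have e : π * (1 - R ^ 2) ^ (α + 1) / (α + 2) * (R ^ 4 * N R) =
      2 * π * ((1 - R ^ 2) ^ (α + 1) * R ^ 4 / (2 * (α + 2)) * N R) := by
    field_simp
  rw [e]
  calc _ = 2 * π * ((∫ r in Set.Ioo 0 R, r ^ 5 * (1 - r ^ 2) ^ α * N r) +
        (1 - R ^ 2) ^ (α + 1) * R ^ 4 / (2 * (α + 2)) * N R) := by ring
    _ ≤ 2 * π * (momentRatio α R * ∫ r in Set.Ioo (0 : ℝ) 1, r ^ 5 * (1 - r ^ 2) ^ α * N r) := by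
        gcongr
    _ = momentRatio α R * (2 * π * ∫ r in Set.Ioo (0 : ℝ) 1, r ^ 5 * (1 - r ^ 2) ^ α * N r) := by
        ring
    _ = momentRatio α R := by rw [hone, mul_one]

/-- Second derivative of a quotient by `1 + ε²`. -/
lemma deriv_div_one_add_sq {F D : ℝ → ℝ} {d : ℝ} (hF : ∀ᶠ ε in 𝓝 (0 : ℝ), HasDerivAt F (D ε) ε)
    (hD : HasDerivAt D d 0) :
    (∀ᶠ ε in 𝓝 (0 : ℝ), DifferentiableAt ℝ (fun ε => F ε / (1 + ε ^ 2)) ε) ∧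
      HasDerivAt (deriv fun ε => F ε / (1 + ε ^ 2)) (d - 2 * F 0) 0 := by
  have hq : ∀ ε : ℝ, HasDerivAt (fun ε : ℝ => 1 + ε ^ 2) (2 * ε) ε := fun ε => by
    simpa using (hasDerivAt_pow 2 ε).const_add 1
  have hne : ∀ ε : ℝ, 1 + ε ^ 2 ≠ 0 := fun ε => by positivity
  have h1 : ∀ᶠ ε in 𝓝 (0 : ℝ), HasDerivAt (fun ε => F ε / (1 + ε ^ 2))
      ((D ε * (1 + ε ^ 2) - F ε * (2 * ε)) / (1 + ε ^ 2) ^ 2) ε := by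
    filter_upwards [hF] with ε hε
    exact hε.div (hq ε) (hne ε)
  refine ⟨h1.mono fun ε hε => hε.differentiableAt, ?_⟩
  have h2 : deriv (fun ε => F ε / (1 + ε ^ 2)) =ᶠ[𝓝 0]
      fun ε => (D ε * (1 + ε ^ 2) - F ε * (2 * ε)) / (1 + ε ^ 2) ^ 2 :=
    h1.mono fun ε hε => hε.deriv
  refine HasDerivAt.congr_of_eventuallyEq ?_ h2
  have hlin : HasDerivAt (fun ε : ℝ => 2 * ε) 2 0 := by
    simpa using (hasDerivAt_id (0 : ℝ)).const_mul 2
  have h3 := ((hD.mul (hq 0)).sub (hF.self_of_nhds.mul hlin)).div ((hq 0).pow 2)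
    (pow_ne_zero 2 (hne 0))
  convert! h3 using 1
  simp
  ring

lemma bound_eq {α s R : ℝ} (hs : 0 < s) (hR : R ^ 2 = s / (π + s)) :
    momentRatio α R - (1 - (1 - R ^ 2) ^ (α + 1)) =
      -((α + 1) * π ^ (α + 1) / 2 * s * (π + s) ^ (-3 - α) * (s + 2 * π)) := by
  have hps : 0 < π + s := by positivity
  have e1 : 1 - R ^ 2 = π / (π + s) := by
    rw [hR]
    field_simp
    ring
  have e2 : (π + s) ^ (-3 - α) = ((π + s) ^ (α + 1))⁻¹ * ((π + s) ^ 2)⁻¹ := by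
    rw [← rpow_neg hps.le, ← rpow_two, ← rpow_neg hps.le, ← rpow_add hps]
    congr 1
    ring
  rw [momentRatio, e1, div_rpow pi_pos.le hps.le, e2, hR]
  have : (π + s) ^ (α + 1) ≠ 0 := (rpow_pos_of_pos hps _).ne'
  field_simp
  ring

end Bergman

end

theorem mainTheorem7 (α : ℝ) (hα : -1 < α) (s : ℝ) (hs : 0 < s)
    (g : ℂ → ℂ) (hg : g ∈ Bergman.space α) (hnorm : Bergman.norm α g = 1)
    (hg_one : Bergman.scalar α g (fun _ => 1) = 0)
    (hg_id : Bergman.scalar α g (fun z => z) = 0) :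
    Bergman.HasSecondVariation α s g ∧
      (1 / 2 : ℝ) * Bergman.secondVariation α s g ≤
        -((α + 1) * Real.pi ^ (α + 1) / 2 * s * (Real.pi + s) ^ (-3 - α) *
          (s + 2 * Real.pi)) := by
  have hps : 0 < π + s := by positivity
  -- This is the radius for which the hyperbolic area `π R² / (1 - R²)` of the disk equals `s`.
  set R := √(s / (π + s)) with hRdef
  have hR2 : R ^ 2 = s / (π + s) := sq_sqrt (by positivity)
  have hR0 : 0 < R := sqrt_pos.2 (by positivity)
  have hR1 : R < 1 := by
    rw [hRdef, sqrt_lt' one_pos, one_pow, div_lt_one hps]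
    linarith [pi_pos]
  have hsR : s = π * R ^ 2 / (1 - R ^ 2) := by
    rw [hR2]
    have : 1 - s / (π + s) = π / (π + s) := by
      field_simp
      ring
    rw [this]
    field_simp
  obtain ⟨ε₀, R₁, t₁, hconf, hRR₁, ht⟩ := Bergman.exists_confined hα hg hR0 hR1 hsR
  obtain ⟨h, hh, hgh⟩ := Bergman.exists_eq_sq_mul hα hg hg_one hg_id
  have hg0 : g 0 = 0 := by simp [hgh]
  have hK : Bergman.KLine α s g =
      fun ε => Bergman.I α (Bergman.pert α g ε) s / (1 + ε ^ 2) := by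
    ext ε
    rw [← Bergman.norm_pert_sq hα hg hnorm hg_one ε]
    rfl
  have hF : ∀ᶠ ε in 𝓝 (0 : ℝ), HasDerivAt (fun ε => Bergman.I α (Bergman.pert α g ε) s)
      (Bergman.Confined.slopeAt α s g ε) ε := by
    filter_upwards [Bergman.Confined.eventually_lt (ε := 0) (by simpa using hconf.ε₀_pos)]
      with ε hε
    exact hconf.hasDerivAt_I hs.le hε
  obtain ⟨hd1, hd2⟩ := Bergman.deriv_div_one_add_sq hF
    (hconf.hasDerivAt_slopeAt hα hs.le hR0 hRR₁ ht hsR hg0)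
  rw [← hK] at hd1 hd2
  refine ⟨⟨hd1, hd2.differentiableAt⟩, ?_⟩
  rw [Bergman.secondVariation, hd2.deriv, ← Bergman.bound_eq hs hR2,
    hconf.I_pert_zero hα hs.le hR0 hRR₁ ht hsR]
  have hq := Bergman.quadratic_form_le hα hg hnorm hh hgh hR0 hR1
  have e : 2 * π * (1 - R ^ 2) ^ (α + 1) / (α + 2) = 2 * (π * (1 - R ^ 2) ^ (α + 1) / (α + 2)) := by
    ring
  rw [e]
  linarith
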